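/- Let $A$ be a finite set of players, let $S^i$ ($i\in A$) be finite strategy sets with $S=\prod_i S^i$, and let $W$ be a finite set of states of an environment. Let $X=\prod_{i}\mathbb R^{S^i}$, let $\Delta^i$ and $\Delta^W$ be the sets of probability vectors on $S^i$ and $W$, and $\Delta=\prod_i\Delta^i$. Let $G^i:S\times W\to\mathbb R$ be payoff functions; $G^i$ also denotes the multilinear extension to $\Delta\times\Delta^W$. Let $\sigma^i:\mathbb R^{S^i}\to\Delta^i$ be continuous with $\sigma^{is}(x^i)>0$ for all $x^i$ and $s\in S^i$. Let $P(\lambda)$, $\lambda\in\Delta$, be stochastic matrices on $W$ such that $\lambda\mapsto P(\lambda)$ is of class $C^1$ on $\Delta$ and, for every $\lambda\in\Delta$, $P(\lambda)$ has a unique invariant probability $\tau(\lambda)\in\Delta^W$. Fix $x_0\in X$ and initial weights $\theta_0^{is}>0$ with $\sum_{s\in S^i}\theta_0^{is}=1$ for every $i$. Consider random profiles $s_n=(s_n^i)_{i}\in S$ ($n\ge1$) and states $w_n\in W$ ($n\ge 0$) on a probability space, and put, for $n\ge0$, $$\theta_n^{is}=\theta_0^{is}+\#\{1\le m\le n:\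 s_m^i=s\},\qquad \lambda_n^{is}=\frac{\theta_n^{is}}{n+1},$$ $$x_{n+1}^{is}=\begin{cases}\bigl(1-\frac1{\theta_n^{is}}\bigr)x_n^{is}+\frac1{\theta_n^{is}}\,G^i(s_{n+1},w_{n+1}),& s=s_{n+1}^i,\\ x_n^{is},&\text{otherwise.}\end{cases}$$ Let $\mathcal F_n$ be the $\sigma$-algebra generated by $w_0$ and $(s_m,w_m)_{1\le m\le n}$, and suppose that for all $n\ge0$, $r\in S$, $w\in W$, almost surely $$\mathbb P(s_{n+1}=r,\ w_{n+1}=w\mid\mathcal F_n)=\Bigl(\prod_{i\in A}\sigma^{ir^i}(x_n^i)\Bigr)P_{w_n,w}(\lambda_n).$$ Consider the averaged dynamics, for $x\in X$ and $\lambda\in\Delta$ with all $\lambda^{is}>0$, $$\dot x^{is}=\frac{\sigma^{is}(x^i)}{\lambda^{is}}\bigl[G^i(s,\sigma^{-i}(x),\tau(\lambda))-x^{is}\bigr],\qquad \dot\lambda^{is}=\sigma^{is}(x^i)-\lambda^{is}.$$ A set $D$ is internally chain transitive (ICT) for these dynamics if it is compact and, for all $\varepsilon>0$, $T>0$ and $a,b\in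 D$, there are $k\ge1$, times $t_1,\dots,t_k>T$ and solutions $y_j$ of the dynamics on $[0,t_j]$ with $y_j([0,t_j])\subseteq D$ such that $\|y_1(0)-a\|<\varepsilon$, $\|y_j(t_j)-y_{j+1}(0)\|<\varepsilon$ for $1\le j<k$, and $\|y_k(t_k)-b\|<\varepsilon$. Then, almost surely, the process $(x_n,\lambda_n)_n$ converges to an ICT set of the averaged dynamics. Precisely: almost surely the set $\mathcal L$ of limits of subsequences of $(x_n,\lambda_n)_n$ is nonempty, is contained in $\{(x,\lambda)\in X\times\Delta:\ \lambda^{is}>0\text{ for all }i,s\}$ and is ICT for the averaged dynamics, and the distance from $(x_n,\lambda_n)$ to $\mathcal L$ tends to $0$. -/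

import Mathlib

open Filter Topology MeasureTheory

noncomputable section

namespace RandomEnvLearning

/-! ### Limit sets and internally chain transitive sets -/

/-- The set of subsequential limits of a sequence `z`. -/
def limitSet {E : Type*} [TopologicalSpace E] (z : ℕ → E) : Set E :=
  {y | ∃ φ : ℕ → ℕ, Tendsto φ atTop atTop ∧ Tendsto (fun l => z (φ l)) atTop (𝓝 y)}

/-- `y` solves `y' = H(y)` on the time interval `[0, t]` (one-sided derivatives at the ends). -/
def IsSolutionOn {E : Type*} [NormedAddCommGroup E] [NormedSpace ℝ E]
    (H : E → E) (y : ℝ → E) (t : ℝ) : Prop :=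
  ∀ u ∈ Set.Icc (0 : ℝ) t, HasDerivWithinAt y (H (y u)) (Set.Icc 0 t) u

/-- There is an `(ε, T)`-chain in `Z` from `a` to `b` for the dynamics `y' = H(y)`. The chain has
`k + 1 ≥ 1` pieces `y 0, …, y k`, run for the times `t 0, …, t k`. -/
def HasChain {E : Type*} [NormedAddCommGroup E] [NormedSpace ℝ E]
    (H : E → E) (Z : Set E) (ε T : ℝ) (a b : E) : Prop :=
  ∃ (k : ℕ) (y : Fin (k + 1) → ℝ → E) (t : Fin (k + 1) → ℝ),
    (∀ j, T < t j) ∧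
    (∀ j, IsSolutionOn H (y j) (t j)) ∧
    (∀ j, ∀ u ∈ Set.Icc (0 : ℝ) (t j), y j u ∈ Z) ∧
    (∀ j : Fin k, ‖y j.castSucc (t j.castSucc) - y j.succ 0‖ < ε) ∧
    ‖y 0 0 - a‖ < ε ∧
    ‖y (Fin.last k) (t (Fin.last k)) - b‖ < ε

/-- `D` is internally chain transitive for the dynamics `y' = H(y)`. -/
def IsICT {E : Type*} [NormedAddCommGroup E] [NormedSpace ℝ E] (H : E → E) (D : Set E) : Prop :=
  IsCompact D ∧ ∀ ε > 0, ∀ T > 0, ∀ a ∈ D, ∀ b ∈ D, HasChain H D ε T a b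

/-! ### The game

`A` is the set of players, `S i` the strategies of player `i`, `W` the states of the environment.
-/

/-- The set `Δ` of mixed strategy profiles. -/
def mixedProfiles {A : Type*} (S : A → Type*) [∀ i, Fintype (S i)] : Set (∀ i, S i → ℝ) :=
  {l | ∀ i, l i ∈ stdSimplex ℝ (S i)}

/-- A decision rule: each `σ i` is a continuous map from perception vectors into the mixed
strategies of player `i` with positive components. -/
structure IsDecisionRule {A : Type*} {S : A → Type*} [∀ i, Fintype (S i)]
    (σ : ∀ i, (S i → ℝ) → S i → ℝ) : Prop where
  continuous : ∀ i, Continuous (σ i)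
  mem_simplex : ∀ i y, σ i y ∈ stdSimplex ℝ (S i)
  pos : ∀ i y r, 0 < σ i y r

/-- The multilinear extension to `Δ × Δ^W` of a payoff function on `S × W`. -/
def multilinearExt {A : Type*} [Fintype A] [DecidableEq A] {S : A → Type*}
    [∀ i, Fintype (S i)] {W : Type*} [Fintype W]
    (g : (∀ i, S i) → W → ℝ) (p : ∀ i, S i → ℝ) (π : W → ℝ) : ℝ :=
  ∑ r : ∀ i, S i, ∑ v : W, (∏ j, p j (r j)) * π v * g r v

/-- `G^i(r, σ^{-i}(x), π)`: the mean payoff of player `i` when she plays the pure strategy `r`,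
her opponents play according to `σ(x)` and the environment has the law `π`. -/
def meanPayoff {A : Type*} [Fintype A] [DecidableEq A] {S : A → Type*}
    [∀ i, Fintype (S i)] [∀ i, DecidableEq (S i)] {W : Type*} [Fintype W]
    (G : A → (∀ i, S i) → W → ℝ) (σ : ∀ i, (S i → ℝ) → S i → ℝ)
    (x : ∀ i, S i → ℝ) (π : W → ℝ) (i : A) (r : S i) : ℝ :=
  multilinearExt (G i) (Function.update (fun j => σ j (x j)) i (Pi.single r 1)) π

/-- The vector field of the averaged dynamics in the variables `(x, λ)`, with payoffs averaged
against `τ λ`. It is meaningful on `stateSpace`. -/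
def averagedField {A : Type*} [Fintype A] [DecidableEq A] {S : A → Type*}
    [∀ i, Fintype (S i)] [∀ i, DecidableEq (S i)] {W : Type*} [Fintype W]
    (G : A → (∀ i, S i) → W → ℝ) (σ : ∀ i, (S i → ℝ) → S i → ℝ)
    (τ : (∀ i, S i → ℝ) → W → ℝ) (z : (∀ i, S i → ℝ) × (∀ i, S i → ℝ)) :
    (∀ i, S i → ℝ) × (∀ i, S i → ℝ) :=
  (fun i r => σ i (z.1 i) r / z.2 i r * (meanPayoff G σ z.1 (τ z.2) i r - z.1 i r),
   fun i r => σ i (z.1 i) r - z.2 i r)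

/-- The points `(x, λ)` of `X × Δ` with `λ^{ir} > 0` for all `i` and `r`. -/
def stateSpace {A : Type*} (S : A → Type*) [∀ i, Fintype (S i)] :
    Set ((∀ i, S i → ℝ) × (∀ i, S i → ℝ)) :=
  {z | z.2 ∈ mixedProfiles S ∧ ∀ i r, 0 < z.2 i r}

/-! ### The learning process

`s n` is the strategy profile played at stage `n ≥ 1` (`s 0` plays no role), and `w n` is the state
of the environment at time `n`. The next three definitions are for one trajectory.
-/

/-- `θ_n^{ir}`: the initial value `θ0 i r` plus the number of stages in `{1, …, n}` at which
player `i` played `r`. -/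
def playCount {A : Type*} {S : A → Type*} [∀ i, DecidableEq (S i)]
    (θ0 : ∀ i, S i → ℝ) (s : ℕ → ∀ i, S i) (n : ℕ) (i : A) (r : S i) : ℝ :=
  θ0 i r + ∑ m ∈ Finset.Icc 1 n, if s m i = r then 1 else 0

/-- The empirical frequencies `λ_n^{ir} = θ_n^{ir} / (n + 1)`. -/
def frequency {A : Type*} {S : A → Type*} [∀ i, DecidableEq (S i)]
    (θ0 : ∀ i, S i → ℝ) (s : ℕ → ∀ i, S i) (n : ℕ) (i : A) (r : S i) : ℝ :=
  playCount θ0 s n i r / (n + 1)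

/-- The perception vectors `x_n`, updated by averaging in the random payoff
`G^i(s_{n+1}, w_{n+1})` on the coordinate of the strategy that was played. -/
def perception {A : Type*} {S : A → Type*} [∀ i, DecidableEq (S i)] {W : Type*}
    (G : A → (∀ i, S i) → W → ℝ) (x0 θ0 : ∀ i, S i → ℝ)
    (s : ℕ → ∀ i, S i) (w : ℕ → W) : ℕ → ∀ i, S i → ℝ
  | 0 => x0
  | n + 1 => fun i r =>
      if s (n + 1) i = r then
        (1 - 1 / playCount θ0 s n i r) * perception G x0 θ0 s w n i r
          + 1 / playCount θ0 s n i r * G i (s (n + 1)) (w (n + 1))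
      else perception G x0 θ0 s w n i r

/-- The history up to time `n`: the σ-algebra generated by the initial state `w 0` and by
`(s m, w m)` for `1 ≤ m ≤ n` (the payoffs are functions of these). -/
abbrev history {Ω A : Type*} {S : A → Type*} {W : Type*}
    (s : ℕ → Ω → ∀ i, S i) (w : ℕ → Ω → W) (n : ℕ) : MeasurableSpace Ω :=
  MeasurableSpace.comap (w 0) ⊤ ⊔
    ⨆ m ∈ Finset.Icc 1 n, (MeasurableSpace.comap (s m) ⊤ ⊔ MeasurableSpace.comap (w m) ⊤)

/-- The strategy profiles `s` and the environment `w` are generated by the learning procedure: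
given the history up to time `n`, the players draw their strategies of stage `n + 1` independently
from `σ^i(x_n^i)`, and independently of them the environment moves by the transition matrix
`P(λ_n)`. -/
structure IsLearningProcess {Ω : Type*} [MeasurableSpace Ω] (μ : Measure Ω)
    {A : Type*} [Fintype A] {S : A → Type*} [∀ i, DecidableEq (S i)] {W : Type*}
    (G : A → (∀ i, S i) → W → ℝ) (σ : ∀ i, (S i → ℝ) → S i → ℝ)
    (P : (∀ i, S i → ℝ) → Matrix W W ℝ) (x0 θ0 : ∀ i, S i → ℝ)
    (s : ℕ → Ω → ∀ i, S i) (w : ℕ → Ω → W) : Prop where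
  measurable_play : ∀ n, Measurable[_, ⊤] (s (n + 1))
  measurable_env : ∀ n, Measurable[_, ⊤] (w n)
  cond_law : ∀ (n : ℕ) (r : ∀ i, S i) (v : W),
    μ[{ω | s (n + 1) ω = r ∧ w (n + 1) ω = v}.indicator (fun _ => (1 : ℝ)) | history s w n]
      =ᵐ[μ] fun ω =>
        (∏ i, σ i (perception G x0 θ0 (fun m => s m ω) (fun m => w m ω) n i) (r i))
          * P (frequency θ0 (fun m => s m ω) n) (w n ω) v

/-- The trajectory `n ↦ (x_n, λ_n)`. -/
def stateSeq {A : Type*} {S : A → Type*} [∀ i, DecidableEq (S i)] {W : Type*}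
    (G : A → (∀ i, S i) → W → ℝ) (x0 θ0 : ∀ i, S i → ℝ)
    (s : ℕ → ∀ i, S i) (w : ℕ → W) (n : ℕ) : (∀ i, S i → ℝ) × (∀ i, S i → ℝ) :=
  (perception G x0 θ0 s w n, frequency θ0 s n)

end RandomEnvLearning

end

/-! The process is a stochastic approximation scheme with steps `1 / (n + 1)`. Along almost every
path, from some time on, `z = (x, λ)` stays in a fixed compact set where the averaged field `H` is
continuous, and `z (n+1) - z n = γ n • (H (z n) + e n) + (c (n+1) - c n)` with `e n → 0` and `c n`
convergent. The limit set of such a sequence is internally chain transitive (`isICT_limitSet`):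
after `c` is absorbed, the interpolated path is an asymptotic pseudo-trajectory, and by
Arzelà–Ascoli its long pieces are shadowed by solutions inside the limit set. Cutting a stretch of
path between visits near `a` and `b` into pieces gives the chain.

Three facts produce this form. Perceptions have a deterministic bound (`abs_perception_le`), so the
choice probabilities are bounded below, and a law of large numbers keeps the frequencies away from
`0`, where the field is singular (`eventually_le_frequency`). Martingale differences with
square-summable bounds have convergent sums (`ae_exists_tendsto_sum_of_condExp_eq_zero`); these sums
go into `c`.

There remains the Markovian noise: the mean payoff given the past depends on the current state `w
n`, not on `τ (λ n)`. The Poisson equation (`poissonSolution_spec`) writes the difference as `u (w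
n)` minus the conditional mean of `u (w (n+1))`. Its solution depends continuously on `z`, and `z`
moves slowly, so these differences telescope up to a vanishing error (`perception_perturbed`). -/

namespace RandomEnvLearning

/-! ### Limit sets of sequences -/

section LimitSet

theorem mem_limitSet_iff_mapClusterPt {E : Type*} [TopologicalSpace E] [FirstCountableTopology E]
    {z : ℕ → E} {y : E} : y ∈ limitSet z ↔ MapClusterPt y atTop z := by
  constructor
  · rintro ⟨φ, hφ, h⟩
    exact MapClusterPt.of_comp hφ h.mapClusterPt
  · intro h
    obtain ⟨φ, hφ, hlim⟩ := h.tendsto_subseq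
    exact ⟨φ, hφ.tendsto_atTop, hlim⟩

theorem isClosed_limitSet {E : Type*} [TopologicalSpace E] [FirstCountableTopology E]
    (z : ℕ → E) : IsClosed (limitSet z) := by
  have : limitSet z = {y | ClusterPt y (map z atTop)} := by
    ext y
    exact mem_limitSet_iff_mapClusterPt
  rw [this]
  exact isClosed_setOfPred_clusterPt

theorem limitSet_subset {E : Type*} [TopologicalSpace E] {z : ℕ → E} {C : Set E}
    (hC : IsClosed C) (hz : ∀ n, z n ∈ C) : limitSet z ⊆ C := by
  rintro y ⟨φ, -, h⟩
  exact hC.mem_of_tendsto h (Eventually.of_forall fun l => hz (φ l))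

theorem limitSet_nonempty {E : Type*} [TopologicalSpace E] [FirstCountableTopology E]
    {z : ℕ → E} {C : Set E} (hC : IsCompact C) (hz : ∀ n, z n ∈ C) : (limitSet z).Nonempty := by
  obtain ⟨y, -, hy⟩ := hC.exists_mapClusterPt_of_frequently (l := atTop) (f := z)
    (Eventually.of_forall hz).frequently
  exact ⟨y, mem_limitSet_iff_mapClusterPt.2 hy⟩

theorem limitSet_shift {E : Type*} [TopologicalSpace E] (z : ℕ → E) (N : ℕ) :
    limitSet (fun n => z (n + N)) = limitSet z := by
  ext y
  constructor
  · rintro ⟨φ, hφ, h⟩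
    exact ⟨fun l => φ l + N, tendsto_atTop_mono (fun l => Nat.le_add_right _ N) hφ, h⟩
  · rintro ⟨φ, hφ, h⟩
    refine ⟨fun l => φ l - N, (tendsto_sub_atTop_nat N).comp hφ, h.congr' ?_⟩
    filter_upwards [hφ.eventually_ge_atTop N] with l hl
    rw [Nat.sub_add_cancel hl]

/-- A subsequence staying at distance `ε` from the limit set would have, by compactness, a cluster
point, which belongs to that set. -/
theorem tendsto_infDist_limitSet {E : Type*} [PseudoMetricSpace E] {z : ℕ → E} {C : Set E}
    (hC : IsCompact C) (hz : ∀ n, z n ∈ C) :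
    Tendsto (fun n => Metric.infDist (z n) (limitSet z)) atTop (𝓝 0) := by
  refine tendsto_order.2 ⟨fun a ha => Eventually.of_forall fun n =>
    ha.trans_le Metric.infDist_nonneg, fun ε hε => ?_⟩
  by_contra hcon
  rw [not_eventually] at hcon
  obtain ⟨φ, hφ, hφε⟩ := extraction_of_frequently_atTop hcon
  obtain ⟨y, -, ψ, hψ, hlim⟩ := hC.tendsto_subseq (x := z ∘ φ) fun n => hz (φ n)
  have hy : y ∈ limitSet z := ⟨φ ∘ ψ, (hφ.comp hψ).tendsto_atTop, hlim⟩
  obtain ⟨n, hn⟩ := (hlim.eventually (Metric.ball_mem_nhds y hε)).exists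
  exact hφε (ψ n) ((Metric.infDist_le_dist_of_mem hy).trans_lt hn)

end LimitSet

/-! ### The time scale of a sequence of step sizes -/

section Clock

variable {γ : ℕ → ℝ}

/-- The time elapsed after `n` steps of sizes `γ 0, γ 1, …`. -/
def clock (γ : ℕ → ℝ) (n : ℕ) : ℝ := ∑ k ∈ Finset.range n, γ k

/-- The number of steps completed at time `t`. -/
noncomputable def clockIndex (γ : ℕ → ℝ) (t : ℝ) : ℕ := sInf {n | t < clock γ (n + 1)}

theorem clock_zero (γ : ℕ → ℝ) : clock γ 0 = 0 := by simp [clock]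

theorem clock_succ (γ : ℕ → ℝ) (n : ℕ) : clock γ (n + 1) = clock γ n + γ n :=
  Finset.sum_range_succ _ _

theorem strictMono_clock (hγ : ∀ n, 0 < γ n) : StrictMono (clock γ) :=
  strictMono_nat_of_lt_succ fun n => by rw [clock_succ]; linarith [hγ n]

theorem clock_nonneg (hγ : ∀ n, 0 < γ n) (n : ℕ) : 0 ≤ clock γ n :=
  Finset.sum_nonneg fun k _ => (hγ k).le

theorem lt_clock_clockIndex_succ (hsum : Tendsto (clock γ) atTop atTop) (t : ℝ) :
    t < clock γ (clockIndex γ t + 1) := by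
  have h : {n | t < clock γ (n + 1)}.Nonempty :=
    ((tendsto_add_atTop_iff_nat 1).2 hsum).eventually_gt_atTop t |>.exists
  exact Nat.sInf_mem h

theorem clock_clockIndex_le {t : ℝ} (ht : 0 ≤ t) : clock γ (clockIndex γ t) ≤ t := by
  rcases hN : clockIndex γ t with _ | m
  · rwa [clock_zero]
  · have h : m ∉ {n | t < clock γ (n + 1)} := Nat.notMem_of_lt_sInf (by
      change m < clockIndex γ t
      omega)
    exact not_lt.1 h

theorem clockIndex_eq (hγ : ∀ n, 0 < γ n) (hsum : Tendsto (clock γ) atTop atTop) {t : ℝ} {n : ℕ}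
    (h1 : clock γ n ≤ t) (h2 : t < clock γ (n + 1)) : clockIndex γ t = n := by
  have hmono := strictMono_clock hγ
  have h3 := lt_clock_clockIndex_succ hsum t
  have h4 := clock_clockIndex_le (γ := γ) ((clock_nonneg hγ n).trans h1)
  have h5 := hmono.lt_iff_lt.1 (h1.trans_lt h3)
  have h6 := hmono.lt_iff_lt.1 (h4.trans_lt h2)
  omega

theorem monotone_clockIndex (hsum : Tendsto (clock γ) atTop atTop) : Monotone (clockIndex γ) :=
  fun _ t h => Nat.sInf_le (h.trans_lt (lt_clock_clockIndex_succ hsum t))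

theorem tendsto_clockIndex (hγ : ∀ n, 0 < γ n) (hsum : Tendsto (clock γ) atTop atTop) :
    Tendsto (clockIndex γ) atTop atTop :=
  tendsto_atTop_atTop_of_monotone (monotone_clockIndex hsum) fun n =>
    ⟨clock γ n, (clockIndex_eq hγ hsum le_rfl (strictMono_clock hγ n.lt_succ_self)).ge⟩

end Clock

/-! ### The interpolated process -/

section Interpolation

theorem stronglyMeasurable_velocity {E : Type*} [TopologicalSpace E] {γ : ℕ → ℝ}
    (hsum : Tendsto (clock γ) atTop atTop) (h : ℕ → E) :
    StronglyMeasurable fun r => h (clockIndex γ r) :=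
  (StronglyMeasurable.of_discrete (f := h)).comp_measurable (monotone_clockIndex hsum).measurable

variable {E : Type*} [NormedAddCommGroup E] {γ : ℕ → ℝ} {h : ℕ → E} {M : ℝ}

theorem intervalIntegrable_velocity (hsum : Tendsto (clock γ) atTop atTop)
    (hM : ∀ n, ‖h n‖ ≤ M) (a b : ℝ) :
    IntervalIntegrable (fun r => h (clockIndex γ r)) volume a b :=
  (intervalIntegrable_const (c := M)).mono_fun
    (stronglyMeasurable_velocity hsum h).aestronglyMeasurable
    (Eventually.of_forall fun _ => (hM _).trans (le_abs_self M))

variable [NormedSpace ℝ E]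

/-- The continuous-time process that starts at `y0` and has velocity `h n` during the `n`-th
step. -/
noncomputable def interpolation (γ : ℕ → ℝ) (h : ℕ → E) (y0 : E) (t : ℝ) : E :=
  y0 + ∫ r in (0 : ℝ)..t, h (clockIndex γ r)

theorem interpolation_sub (hsum : Tendsto (clock γ) atTop atTop) (hM : ∀ n, ‖h n‖ ≤ M)
    (y0 : E) (a b : ℝ) :
    interpolation γ h y0 b - interpolation γ h y0 a = ∫ r in a..b, h (clockIndex γ r) := by
  unfold interpolation
  rw [add_sub_add_left_eq_sub, intervalIntegral.integral_interval_sub_left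
    (intervalIntegrable_velocity hsum hM _ _) (intervalIntegrable_velocity hsum hM _ _)]

theorem norm_interpolation_sub_le (hsum : Tendsto (clock γ) atTop atTop) (hM : ∀ n, ‖h n‖ ≤ M)
    (y0 : E) (a b : ℝ) :
    ‖interpolation γ h y0 b - interpolation γ h y0 a‖ ≤ M * |b - a| := by
  rw [interpolation_sub hsum hM]
  exact intervalIntegral.norm_integral_le_of_norm_le_const fun r _ => hM _

theorem interpolation_clock [CompleteSpace E] (hγ : ∀ n, 0 < γ n)
    (hsum : Tendsto (clock γ) atTop atTop)
    (hM : ∀ n, ‖h n‖ ≤ M) {y : ℕ → E} (hy : ∀ n, y (n + 1) = y n + γ n • h n) (n : ℕ) :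
    interpolation γ h (y 0) (clock γ n) = y n := by
  induction n with
  | zero => simp [interpolation, clock_zero]
  | succ n ih =>
    have hlt := strictMono_clock hγ n.lt_succ_self
    have h1 : ∫ r in clock γ n..clock γ (n + 1), h (clockIndex γ r) = γ n • h n := by
      rw [intervalIntegral.integral_congr_uIoo (g := fun _ => h n)]
      · rw [intervalIntegral.integral_const, clock_succ, add_sub_cancel_left]
      · intro r hr
        rw [Set.uIoo_of_lt hlt] at hr
        simp only [clockIndex_eq hγ hsum hr.1.le hr.2]
    rw [hy, ← ih, ← h1, ← interpolation_sub hsum hM (y 0), add_sub_cancel]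

/-- During step `n` the interpolation moves by at most `M * γ n`. -/
theorem tendsto_interpolation_sub [CompleteSpace E] (hγ : ∀ n, 0 < γ n)
    (hγ0 : Tendsto γ atTop (𝓝 0))
    (hsum : Tendsto (clock γ) atTop atTop)
    (hM : ∀ n, ‖h n‖ ≤ M) {y : ℕ → E} (hy : ∀ n, y (n + 1) = y n + γ n • h n) :
    Tendsto (fun t => interpolation γ h (y 0) t - y (clockIndex γ t)) atTop (𝓝 0) := by
  have hM0 : 0 ≤ M := (norm_nonneg _).trans (hM 0)
  have hlim : Tendsto (fun t => M * γ (clockIndex γ t)) atTop (𝓝 0) := by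
    simpa using (hγ0.comp (tendsto_clockIndex hγ hsum)).const_mul M
  refine squeeze_zero_norm' ?_ hlim
  filter_upwards [eventually_ge_atTop 0] with t ht
  have h1 := clock_clockIndex_le (γ := γ) ht
  have h2 := lt_clock_clockIndex_succ hsum t
  rw [clock_succ] at h2
  rw [← interpolation_clock hγ hsum hM hy (clockIndex γ t)]
  refine (norm_interpolation_sub_le hsum hM _ _ _).trans ?_
  rw [abs_of_nonneg (by linarith)]
  exact mul_le_mul_of_nonneg_left (by linarith) hM0

end Interpolation

/-! ### Compactness for uniformly Lipschitz curves -/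

/-- Arzelà–Ascoli on `[0, T]`. The limit is extended by constants outside the interval, so that
whatever set contains its values on `[0, T]` contains them on all of `ℝ`. -/
theorem exists_subseq_tendsto_of_lipschitz {E : Type*} [NormedAddCommGroup E] [ProperSpace E]
    {f : ℕ → ℝ → E} {M R T : ℝ} (hT : 0 ≤ T)
    (hlip : ∀ k s t, ‖f k t - f k s‖ ≤ M * |t - s|)
    (hR : ∀ k, ∀ t ∈ Set.Icc 0 T, ‖f k t‖ ≤ R) :
    ∃ (φ : ℕ → ℕ) (g : ℝ → E), StrictMono φ ∧ Continuous g ∧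
      (∀ r, g r = g (Set.projIcc 0 T hT r)) ∧
      ∀ ε > 0, ∀ᶠ k in atTop, ∀ t ∈ Set.Icc 0 T, ‖f (φ k) t - g t‖ < ε := by
  have hcont : ∀ k, Continuous (f k) := fun k =>
    (LipschitzWith.of_dist_le' (K := M) fun s t => by
      rw [dist_eq_norm, Real.dist_eq]
      exact hlip k t s).continuous
  let F : ℕ → BoundedContinuousFunction (Set.Icc (0 : ℝ) T) E := fun k =>
    BoundedContinuousFunction.mkOfCompact ⟨fun t => f k t, (hcont k).comp continuous_subtype_val⟩
  have hcomp : IsCompact (closure (Set.range F)) := by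
    refine BoundedContinuousFunction.arzela_ascoli (Metric.closedBall 0 R)
      (isCompact_closedBall 0 R) _ ?_ ?_
    · rintro _ t ⟨k, rfl⟩
      rw [mem_closedBall_zero_iff]
      exact hR k t t.2
    · refine Metric.equicontinuous_of_continuity_modulus (fun d => M * d) ?_ _ ?_
      · have : Continuous fun d : ℝ => M * d := by fun_prop
        simpa using this.tendsto 0
      · rintro s t ⟨_, k, rfl⟩
        rw [dist_eq_norm, Subtype.dist_eq, Real.dist_eq]
        exact hlip k t s
  obtain ⟨G, -, φ, hφ, hlim⟩ := hcomp.tendsto_subseq (x := F)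
    fun k => subset_closure ⟨k, rfl⟩
  refine ⟨φ, Set.IccExtend hT G, hφ, G.continuous.Icc_extend', ?_, ?_⟩
  · intro r
    simp [Set.IccExtend]
  · intro ε hε
    filter_upwards [hlim.eventually (Metric.ball_mem_nhds G hε)] with k hk t ht
    rw [Set.IccExtend_of_mem hT G ht, ← dist_eq_norm]
    exact (BoundedContinuousFunction.dist_coe_le_dist ⟨t, ht⟩).trans_lt hk

/-! ### Limit sets of perturbed solutions -/

section Perturbed

variable {E : Type*} [NormedAddCommGroup E] [NormedSpace ℝ E] {γ : ℕ → ℝ}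

theorem IsSolutionOn.mono {H : E → E} {y : ℝ → E} {t t' : ℝ} (h : IsSolutionOn H y t)
    (ht : t' ≤ t) : IsSolutionOn H y t' := fun u hu =>
  (h u ⟨hu.1, hu.2.trans ht⟩).mono (Set.Icc_subset_Icc_right ht)

theorem isSolutionOn_of_integral [CompleteSpace E] {H : E → E} {g : ℝ → E} {T : ℝ}
    (hcont : Continuous fun r => H (g r))
    (hg : ∀ u ∈ Set.Icc 0 T, g u = g 0 + ∫ r in (0 : ℝ)..u, H (g r)) : IsSolutionOn H g T := by
  intro u hu
  have h1 : HasDerivAt (fun u => g 0 + ∫ r in (0 : ℝ)..u, H (g r)) (H (g u)) u :=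
    (hcont.integral_hasStrictDerivAt 0 u).hasDerivAt.const_add _
  exact h1.hasDerivWithinAt.congr hg (hg u hu)

/-- The pieces of the interpolation of a perturbed solution follow, from some time on, solutions
that stay in the limit set. -/
theorem exists_solution_near_interpolation [ProperSpace E] {H : E → E} {C : Set E}
    (hC : IsCompact C) (hH : ContinuousOn H C)
    (hγ : ∀ n, 0 < γ n) (hγ0 : Tendsto γ atTop (𝓝 0)) (hsum : Tendsto (clock γ) atTop atTop)
    {z y h : ℕ → E} (hz : ∀ n, z n ∈ C) (hzy : Tendsto (fun n => y n - z n) atTop (𝓝 0))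
    (hh : Tendsto (fun n => h n - H (z n)) atTop (𝓝 0))
    (hy : ∀ n, y (n + 1) = y n + γ n • h n) {T ε : ℝ} (hT : 0 ≤ T) (hε : 0 < ε) :
    ∃ t0, ∀ t ≥ t0, ∃ v : ℝ → E, IsSolutionOn H v T ∧ (∀ u ∈ Set.Icc 0 T, v u ∈ limitSet z) ∧
      ∀ u ∈ Set.Icc 0 T, ‖interpolation γ h (y 0) (t + u) - v u‖ < ε := by
  -- Otherwise there are bad times `t k → ∞`. A limit of the translates of the interpolation by
  -- these times turns out to be a solution in the limit set, which contradicts badness.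
  by_contra! hcon
  choose t ht hbad using fun k : ℕ => hcon (k : ℝ)
  have ht_top : Tendsto t atTop atTop := tendsto_atTop_mono ht tendsto_natCast_atTop_atTop
  obtain ⟨M, hM⟩ : ∃ M, ∀ n, ‖h n‖ ≤ M := by
    obtain ⟨M1, hM1⟩ := (hC.image_of_continuousOn hH).isBounded.exists_norm_le
    obtain ⟨M2, hM2⟩ := hh.norm.bddAbove_range
    refine ⟨M2 + M1, fun n => ?_⟩
    calc ‖h n‖ = ‖(h n - H (z n)) + H (z n)‖ := by rw [sub_add_cancel]
      _ ≤ _ := (norm_add_le _ _).trans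
        (add_le_add (hM2 ⟨n, rfl⟩) (hM1 _ ⟨z n, hz n, rfl⟩))
  set Y := interpolation γ h (y 0) with hYdef
  have hYz : Tendsto (fun t => Y t - z (clockIndex γ t)) atTop (𝓝 0) := by
    have h1 := (tendsto_interpolation_sub hγ hγ0 hsum hM hy).add
      (hzy.comp (tendsto_clockIndex hγ hsum))
    simpa using h1
  obtain ⟨R, hR⟩ : ∃ R, ∀ᶠ t in atTop, ‖Y t‖ ≤ R := by
    obtain ⟨R, hR⟩ := hC.isBounded.exists_norm_le
    refine ⟨1 + R, ?_⟩
    filter_upwards [hYz.norm.eventually (gt_mem_nhds (show ‖(0 : E)‖ < 1 by simp))] with t ht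
    calc ‖Y t‖ = ‖(Y t - z (clockIndex γ t)) + z (clockIndex γ t)‖ := by rw [sub_add_cancel]
      _ ≤ _ := (norm_add_le _ _).trans (add_le_add ht.le (hR _ (hz _)))
  obtain ⟨t1, ht1⟩ := eventually_atTop.1 hR
  obtain ⟨k1, hk1⟩ := eventually_atTop.1 (ht_top.eventually_ge_atTop t1)
  have ht_top' : Tendsto (fun k => t (k + k1)) atTop atTop := (tendsto_add_atTop_iff_nat k1).2 ht_top
  obtain ⟨φ, g, hφ, hg_cont, hg_proj, hlim⟩ := exists_subseq_tendsto_of_lipschitz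
    (f := fun k u => Y (t (k + k1) + u)) (M := M) (R := R) hT
    (fun k s u => by
      have := norm_interpolation_sub_le hsum hM (y 0) (t (k + k1) + s) (t (k + k1) + u)
      rwa [add_sub_add_left_eq_sub] at this)
    (fun k u hu => ht1 _ ((hk1 _ (Nat.le_add_left k1 k)).trans (le_add_of_nonneg_right hu.1)))
  set τ : ℕ → ℝ := fun k => t (φ k + k1) with hτ
  have hτ_top : Tendsto τ atTop atTop := ht_top'.comp hφ.tendsto_atTop
  have hτu_top : ∀ u, Tendsto (fun k => τ k + u) atTop atTop := fun u =>
    tendsto_atTop_add_const_right _ _ hτ_top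
  have hYg : ∀ u ∈ Set.Icc 0 T, Tendsto (fun k => Y (τ k + u)) atTop (𝓝 (g u)) := by
    intro u hu
    rw [Metric.tendsto_nhds]
    intro δ hδ
    filter_upwards [hlim δ hδ] with k hk
    rw [dist_eq_norm]
    exact hk u hu
  have hzg : ∀ u ∈ Set.Icc 0 T,
      Tendsto (fun k => z (clockIndex γ (τ k + u))) atTop (𝓝 (g u)) := by
    intro u hu
    simpa using (hYg u hu).sub (hYz.comp (hτu_top u))
  have hgL : ∀ u ∈ Set.Icc 0 T, g u ∈ limitSet z := fun u hu =>
    ⟨_, (tendsto_clockIndex hγ hsum).comp (hτu_top u), hzg u hu⟩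
  -- The constant extension of `g` gives this for every real `u`, hence the continuity of `H ∘ g` on
  -- the whole line.
  have hgC : ∀ u, g u ∈ C := fun u => by
    rw [hg_proj]
    exact limitSet_subset hC.isClosed hz (hgL _ (Set.projIcc 0 T hT u).2)
  have hHg : Continuous fun r => H (g r) := hH.comp_continuous hg_cont hgC
  have hhg : ∀ u ∈ Set.Icc 0 T,
      Tendsto (fun k => h (clockIndex γ (τ k + u))) atTop (𝓝 (H (g u))) := by
    intro u hu
    have h1 : Tendsto (fun k => z (clockIndex γ (τ k + u))) atTop (𝓝[C] (g u)) :=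
      tendsto_nhdsWithin_iff.2 ⟨hzg u hu, Eventually.of_forall fun k => hz _⟩
    have h2 := (hH (g u) (hgC u)).tendsto.comp h1
    simpa using (hh.comp ((tendsto_clockIndex hγ hsum).comp (hτu_top u))).add h2
  have hsol : IsSolutionOn H g T := by
    refine isSolutionOn_of_integral hHg fun u hu => ?_
    have h0 : (0 : ℝ) ∈ Set.Icc 0 T := ⟨le_rfl, hT⟩
    have h1 : Tendsto (fun k => Y (τ k + u) - Y (τ k + 0)) atTop (𝓝 (g u - g 0)) :=
      (hYg u hu).sub (hYg 0 h0)
    -- The velocities converge pointwise to `H (g r)` and are bounded by `M`, so the integral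
    -- equation passes to the limit.
    have h2 : Tendsto (fun k => ∫ r in (0 : ℝ)..u, h (clockIndex γ (τ k + r))) atTop
        (𝓝 (∫ r in (0 : ℝ)..u, H (g r))) := by
      refine intervalIntegral.tendsto_integral_filter_of_dominated_convergence (fun _ => M)
        (Eventually.of_forall fun k => ?_) (Eventually.of_forall fun k => ?_)
        intervalIntegrable_const ?_
      · exact ((stronglyMeasurable_velocity hsum h).comp_measurable
          (measurable_const_add (τ k))).aestronglyMeasurable
      · exact Eventually.of_forall fun r _ => hM _
      · refine Eventually.of_forall fun r hr => hhg r ?_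
        rw [Set.uIoc_of_le hu.1] at hr
        exact ⟨hr.1.le, hr.2.trans hu.2⟩
    have h3 : (fun k => Y (τ k + u) - Y (τ k + 0)) =
        fun k => ∫ r in (0 : ℝ)..u, h (clockIndex γ (τ k + r)) := by
      funext k
      rw [intervalIntegral.integral_comp_add_left (fun r => h (clockIndex γ r)),
        hYdef, interpolation_sub hsum hM]
    rw [h3] at h1
    rw [← tendsto_nhds_unique h1 h2, add_sub_cancel]
  obtain ⟨k, hk⟩ := (hlim ε hε).exists
  obtain ⟨u, hu, hlt⟩ := hbad (φ k + k1) g hsol hgL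
  exact absurd (hk u hu) (not_lt.2 hlt)

/-- The limit set of a bounded perturbed solution of `y' = H(y)` is internally chain transitive. -/
theorem isICT_limitSet [ProperSpace E] {H : E → E} {C : Set E}
    (hC : IsCompact C) (hH : ContinuousOn H C)
    (hγ : ∀ n, 0 < γ n) (hγ0 : Tendsto γ atTop (𝓝 0)) (hsum : Tendsto (clock γ) atTop atTop)
    {z e c : ℕ → E} {c' : E} (hz : ∀ n, z n ∈ C) (he : Tendsto e atTop (𝓝 0))
    (hc : Tendsto c atTop (𝓝 c'))
    (hrec : ∀ n, z (n + 1) - z n = γ n • (H (z n) + e n) + (c (n + 1) - c n)) :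
    IsICT H (limitSet z) := by
  have hLC := limitSet_subset hC.isClosed hz
  refine ⟨hC.of_isClosed_subset (isClosed_limitSet z) hLC, fun ε hε T hT a ha b hb => ?_⟩
  -- Subtracting `c` leaves a recursion with velocities alone; adding the limit `c'` makes `y - z`
  -- tend to `0`.
  set y : ℕ → E := fun n => z n - c n + c' with hydef
  set h : ℕ → E := fun n => H (z n) + e n with hhdef
  have hy : ∀ n, y (n + 1) = y n + γ n • h n := fun n => by
    have h1 := hrec n
    simp only [hydef, hhdef]
    rw [sub_eq_iff_eq_add] at h1
    rw [h1]
    abel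
  have hzy : Tendsto (fun n => y n - z n) atTop (𝓝 0) := by
    have h1 := hc.const_sub c'
    rw [sub_self] at h1
    refine h1.congr fun n => ?_
    simp only [hydef]
    abel
  have hh : Tendsto (fun n => h n - H (z n)) atTop (𝓝 0) := by simpa [hhdef] using he
  obtain ⟨M, hM⟩ : ∃ M, ∀ n, ‖h n‖ ≤ M := by
    obtain ⟨M1, hM1⟩ := (hC.image_of_continuousOn hH).isBounded.exists_norm_le
    obtain ⟨M2, hM2⟩ := he.norm.bddAbove_range
    exact ⟨M1 + M2, fun n => (norm_add_le _ _).trans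
        (add_le_add (hM1 _ ⟨z n, hz n, rfl⟩) (hM2 ⟨n, rfl⟩))⟩
  -- The horizon `4 * T` covers the pieces chosen below, of length at most `4 * T`. The radius is `ε
  -- / 2` because at a junction two solutions are compared through the same point of the
  -- interpolation.
  obtain ⟨t0, ht0⟩ := exists_solution_near_interpolation hC hH hγ hγ0 hsum hz hzy hh hy
    (show 0 ≤ 4 * T by linarith) (half_pos hε)
  set Y := interpolation γ h (y 0) with hYdef
  have hnear : ∀ p ∈ limitSet z, ∀ t1, ∃ t ≥ t1, ‖Y t - p‖ < ε / 2 := by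
    rintro p ⟨φ, hφ, hlim⟩ t1
    have h1 : Tendsto (fun l => Y (clock γ (φ l))) atTop (𝓝 p) := by
      have h2 : Tendsto (fun l => y (φ l)) atTop (𝓝 p) := by
        simpa using (hzy.comp hφ).add hlim
      refine h2.congr fun l => ?_
      rw [hYdef, interpolation_clock hγ hsum hM hy]
    obtain ⟨l, hl1, hl2⟩ := ((h1.eventually (Metric.ball_mem_nhds p (half_pos hε))).and
      ((hsum.comp hφ).eventually_ge_atTop t1)).exists
    exact ⟨_, hl2, by rw [← dist_eq_norm]; exact hl1⟩
  obtain ⟨ta, hta, hYa⟩ := hnear a ha t0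
  obtain ⟨tb, htb, hYb⟩ := hnear b hb (ta + 2 * T)
  -- With `m ≥ 1` equal pieces, each length `ℓ` satisfies `2 * T ≤ ℓ < 2 * T * (m + 1) / m ≤ 4 * T`.
  set m := ⌊(tb - ta) / (2 * T)⌋₊ with hm
  have h2T : 0 < 2 * T := by linarith
  have hm1 : 1 ≤ m := Nat.le_floor (by rw [Nat.cast_one, le_div_iff₀ h2T]; linarith)
  have hle : (m : ℝ) * (2 * T) ≤ tb - ta := by
    rw [← le_div_iff₀ h2T]
    exact Nat.floor_le (div_nonneg (by linarith) h2T.le)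
  have hlt : tb - ta < ((m : ℝ) + 1) * (2 * T) := by
    rw [← div_lt_iff₀ h2T]
    exact Nat.lt_floor_add_one _
  have hm1' : (1 : ℝ) ≤ m := by exact_mod_cast hm1
  have hmpos : (0 : ℝ) < m := by linarith
  set ℓ := (tb - ta) / m with hℓ
  have hmℓ : (m : ℝ) * ℓ = tb - ta := by rw [hℓ]; field_simp
  have hℓ1 : T < ℓ := by
    rw [hℓ, lt_div_iff₀ hmpos]
    nlinarith
  have hℓ2 : ℓ ≤ 4 * T := by
    rw [hℓ, div_le_iff₀ hmpos]
    nlinarith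
  have hℓ0 : 0 ≤ ℓ := by linarith
  obtain ⟨k, hk⟩ : ∃ k, m = k + 1 := ⟨m - 1, by omega⟩
  have hkℓ : ((k : ℝ) + 1) * ℓ = tb - ta := by rw [← hmℓ, hk]; push_cast; ring
  choose v hv1 hv2 hv3 using fun j : Fin (k + 1) => ht0 (ta + (j : ℕ) * ℓ)
    (hta.trans (le_add_of_nonneg_right (by positivity)))
  have hℓmem : ℓ ∈ Set.Icc 0 (4 * T) := ⟨hℓ0, hℓ2⟩
  have h0mem : (0 : ℝ) ∈ Set.Icc 0 (4 * T) := ⟨le_rfl, by linarith⟩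
  refine ⟨k, v, fun _ => ℓ, fun _ => hℓ1, fun j => (hv1 j).mono hℓ2,
    fun j u hu => hv2 j u ⟨hu.1, hu.2.trans hℓ2⟩, fun j => ?_, ?_, ?_⟩
  · have h1 := hv3 j.castSucc ℓ hℓmem
    have h2 := hv3 j.succ 0 h0mem
    have h3 : ta + ((j.succ : ℕ) : ℝ) * ℓ + 0 = ta + ((j.castSucc : ℕ) : ℝ) * ℓ + ℓ := by
      simp
      ring
    rw [h3] at h2
    rw [norm_sub_rev] at h1
    have h4 := norm_sub_le_norm_sub_add_norm_sub (v j.castSucc ℓ)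
      (Y (ta + ((j.castSucc : ℕ) : ℝ) * ℓ + ℓ)) (v j.succ 0)
    linarith
  · have h1 := hv3 0 0 h0mem
    simp only [Fin.val_zero, Nat.cast_zero, zero_mul, add_zero] at h1
    rw [norm_sub_rev] at h1
    have h4 := norm_sub_le_norm_sub_add_norm_sub (v 0 0) (Y ta) a
    linarith
  · have h1 := hv3 (Fin.last k) ℓ hℓmem
    have h3 : ta + ((Fin.last k : ℕ) : ℝ) * ℓ + ℓ = tb := by
      rw [Fin.val_last]
      linarith
    rw [h3, norm_sub_rev] at h1
    have h4 := norm_sub_le_norm_sub_add_norm_sub (v (Fin.last k) ℓ) (Y tb) b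
    linarith

end Perturbed

/-! ### The Poisson equation of a finite Markov chain -/

section Poisson

open Matrix

variable {W : Type*} [Fintype W] [DecidableEq W]

/-- The matrix `1 - Q + J`, where all entries of `J` are `1`. -/
def poissonMatrix (Q : Matrix W W ℝ) : Matrix W W ℝ := 1 - Q + Matrix.of fun _ _ => 1

theorem vecMul_poissonMatrix (Q : Matrix W W ℝ) (v : W → ℝ) (j : W) :
    (v ᵥ* poissonMatrix Q) j = v j - (v ᵥ* Q) j + ∑ i, v i := by
  simp only [poissonMatrix, vecMul_add, vecMul_sub, vecMul_one, Pi.add_apply, Pi.sub_apply]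
  simp [vecMul, dotProduct]

theorem poissonMatrix_mulVec (Q : Matrix W W ℝ) (v : W → ℝ) (j : W) :
    (poissonMatrix Q *ᵥ v) j = v j - (Q *ᵥ v) j + ∑ i, v i := by
  simp only [poissonMatrix, add_mulVec, sub_mulVec, one_mulVec, Pi.add_apply, Pi.sub_apply]
  simp [mulVec, dotProduct]

theorem sum_vecMul_of_mem_rowStochastic {Q : Matrix W W ℝ} (hQ : Q ∈ rowStochastic ℝ W)
    (v : W → ℝ) : ∑ j, (v ᵥ* Q) j = ∑ i, v i := by
  simp only [vecMul, dotProduct]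
  rw [Finset.sum_comm]
  refine Finset.sum_congr rfl fun i _ => ?_
  rw [← Finset.mul_sum, sum_row_of_mem_rowStochastic hQ, mul_one]

/-- The triangle inequality gives `|v| ≤ |v| Q` entrywise, and both sides have the same total mass.
-/
theorem abs_vecMul_eq {Q : Matrix W W ℝ} (hQ : Q ∈ rowStochastic ℝ W) {v : W → ℝ}
    (hv : v ᵥ* Q = v) : (fun j => |v j|) ᵥ* Q = fun j => |v j| := by
  have hle : ∀ j ∈ Finset.univ, |v j| ≤ ((fun j => |v j|) ᵥ* Q) j := fun j _ => by
    conv_lhs => rw [← hv]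
    simp only [vecMul, dotProduct]
    refine (Finset.abs_sum_le_sum_abs _ _).trans_eq (Finset.sum_congr rfl fun i _ => ?_)
    rw [abs_mul, abs_of_nonneg (nonneg_of_mem_rowStochastic hQ)]
  have h := (Finset.sum_eq_sum_iff_of_le hle).1 (sum_vecMul_of_mem_rowStochastic hQ _).symm
  exact funext fun j => (h j (Finset.mem_univ j)).symm

/-- Summing the entries of `v (1 - Q + J) = 0` shows that a left null vector `v` has mass zero,
hence is invariant. If `v ≠ 0`, then `|v|` and `|v| + v` are invariant, nonnegative and of equal
mass, so uniqueness of the invariant probability forces `v = 0`. -/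
theorem det_poissonMatrix_ne_zero {Q : Matrix W W ℝ} (hQ : Q ∈ rowStochastic ℝ W) {ν : W → ℝ}
    (hν : ∀ π : W → ℝ, (π ∈ stdSimplex ℝ W ∧ π ᵥ* Q = π) ↔ π = ν) :
    (poissonMatrix Q).det ≠ 0 := by
  intro hdet
  obtain ⟨v, hv0, hv⟩ := exists_vecMul_eq_zero_iff.2 hdet
  have hv' : ∀ j, v j - (v ᵥ* Q) j + ∑ i, v i = 0 := fun j => by
    rw [← vecMul_poissonMatrix, hv, Pi.zero_apply]
  obtain ⟨j0, hj0⟩ := Function.ne_iff.1 hv0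
  have : Nonempty W := ⟨j0⟩
  have hsum : ∑ i, v i = 0 := by
    have h1 : ∑ j, (v j - (v ᵥ* Q) j + ∑ i, v i) = 0 := Finset.sum_eq_zero fun j _ => hv' j
    rw [Finset.sum_add_distrib, Finset.sum_sub_distrib, sum_vecMul_of_mem_rowStochastic hQ,
      sub_self, zero_add, Finset.sum_const, smul_eq_zero] at h1
    exact h1.resolve_left Fintype.card_ne_zero
  have hinv : v ᵥ* Q = v := funext fun j => by linarith [hv' j]
  have habs := abs_vecMul_eq hQ hinv
  set m := ∑ j, |v j| with hm
  have hmpos : 0 < m := Finset.sum_pos' (fun j _ => abs_nonneg _)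
    ⟨j0, Finset.mem_univ _, abs_pos.2 hj0⟩
  have h1 : (m⁻¹ • fun j => |v j|) = ν := (hν _).1 ⟨⟨fun j => by
      simp only [Pi.smul_apply, smul_eq_mul]; positivity, by
      simp only [Pi.smul_apply, smul_eq_mul, ← Finset.mul_sum]
      exact inv_mul_cancel₀ hmpos.ne'⟩, by rw [smul_vecMul, habs]⟩
  have h2 : (m⁻¹ • ((fun j => |v j|) + v)) = ν := (hν _).1 ⟨⟨fun j => by
      simp only [Pi.smul_apply, Pi.add_apply, smul_eq_mul]
      exact mul_nonneg (inv_nonneg.2 hmpos.le) (by linarith [neg_abs_le (v j)]), by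
      simp only [Pi.smul_apply, Pi.add_apply, smul_eq_mul, ← Finset.mul_sum,
        Finset.sum_add_distrib, hsum, add_zero]
      exact inv_mul_cancel₀ hmpos.ne'⟩, by rw [smul_vecMul, add_vecMul, habs, hinv]⟩
  have h3 := congrFun (h2.trans h1.symm) j0
  simp only [Pi.smul_apply, Pi.add_apply, smul_eq_mul] at h3
  have h4 := mul_left_cancel₀ (inv_ne_zero hmpos.ne') h3
  exact hj0 (by simpa using h4)

/-- Invariance and mass one give `ν (1 - Q + J) = 1`. This explicit formula is what makes `ν`
continuous in `Q`. -/
theorem eq_one_vecMul_inv_poissonMatrix {Q : Matrix W W ℝ} (hQ : Q ∈ rowStochastic ℝ W)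
    {ν : W → ℝ} (hν : ∀ π : W → ℝ, (π ∈ stdSimplex ℝ W ∧ π ᵥ* Q = π) ↔ π = ν) :
    ν = 1 ᵥ* (poissonMatrix Q)⁻¹ := by
  obtain ⟨hν1, hν2⟩ := (hν ν).2 rfl
  have h1 : ν ᵥ* poissonMatrix Q = 1 := funext fun j => by
    rw [vecMul_poissonMatrix, hν2, hν1.2, sub_self, zero_add, Pi.one_apply]
  rw [← h1, vecMul_vecMul, mul_nonsing_inv _ (det_poissonMatrix_ne_zero hQ hν).isUnit, vecMul_one]

/-- The solution of the Poisson equation for the function `Q *ᵥ f`. -/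
noncomputable def poissonSolution (Q : Matrix W W ℝ) (f : W → ℝ) : W → ℝ :=
  (poissonMatrix Q)⁻¹ *ᵥ (Q *ᵥ f)

/-- The equation `(1 - Q + J) u = Q f` is the claim once `J u` is known, and `∑ u = 1 (1 - Q + J)⁻¹
Q f = ν Q f = ν f`. The function enters as `Q f` because payoffs are evaluated at the next state. -/
theorem poissonSolution_spec {Q : Matrix W W ℝ} (hQ : Q ∈ rowStochastic ℝ W) {ν : W → ℝ}
    (hν : ∀ π : W → ℝ, (π ∈ stdSimplex ℝ W ∧ π ᵥ* Q = π) ↔ π = ν) (f : W → ℝ) (v : W) :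
    (Q *ᵥ f) v + (Q *ᵥ poissonSolution Q f) v - poissonSolution Q f v = ν ⬝ᵥ f := by
  have hunit := (det_poissonMatrix_ne_zero hQ hν).isUnit
  set u := poissonSolution Q f with hu
  have hBu : poissonMatrix Q *ᵥ u = Q *ᵥ f := by
    rw [hu, poissonSolution, mulVec_mulVec, mul_nonsing_inv _ hunit, one_mulVec]
  have hsum : ∑ i, u i = ν ⬝ᵥ f := by
    have h1 : ∑ i, u i = 1 ⬝ᵥ u := by simp [dotProduct]
    rw [h1, hu, poissonSolution, dotProduct_mulVec, ← eq_one_vecMul_inv_poissonMatrix hQ hν,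
      dotProduct_mulVec, ((hν ν).2 rfl).2]
  have h2 := congrFun hBu v
  rw [poissonMatrix_mulVec] at h2
  linarith

variable {Y : Type*} [TopologicalSpace Y] {D : Set Y} {Q : Y → Matrix W W ℝ} {ν : Y → W → ℝ}

theorem continuousOn_inv_poissonMatrix (hQ : ∀ l ∈ D, Q l ∈ rowStochastic ℝ W)
    (hν : ∀ l ∈ D, ∀ π : W → ℝ, (π ∈ stdSimplex ℝ W ∧ π ᵥ* Q l = π) ↔ π = ν l)
    (hcont : ContinuousOn Q D) : ContinuousOn (fun l => (poissonMatrix (Q l))⁻¹) D := by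
  have h1 : ContinuousOn (fun l => poissonMatrix (Q l)) D :=
    (continuousOn_const.sub hcont).add continuousOn_const
  intro l hl
  have h2 := det_poissonMatrix_ne_zero (hQ l hl) (hν l hl)
  have h3 := continuousAt_matrix_inv (poissonMatrix (Q l)) (by
    rw [Ring.inverse_eq_inv']
    exact continuousAt_inv₀ h2)
  exact ContinuousAt.comp_continuousWithinAt (f := fun l => poissonMatrix (Q l)) h3 (h1 l hl)

theorem continuousOn_invariant (hQ : ∀ l ∈ D, Q l ∈ rowStochastic ℝ W)
    (hν : ∀ l ∈ D, ∀ π : W → ℝ, (π ∈ stdSimplex ℝ W ∧ π ᵥ* Q l = π) ↔ π = ν l)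
    (hcont : ContinuousOn Q D) : ContinuousOn ν D := by
  have h1 := continuousOn_inv_poissonMatrix hQ hν hcont
  have h2 : ContinuousOn (fun l => (1 : W → ℝ) ᵥ* (poissonMatrix (Q l))⁻¹) D := by
    rw [continuousOn_iff_continuous_domRestrict] at h1 ⊢
    exact continuous_const.matrix_vecMul h1
  exact h2.congr fun l hl => eq_one_vecMul_inv_poissonMatrix (hQ l hl) (hν l hl)

theorem continuousOn_poissonSolution (hQ : ∀ l ∈ D, Q l ∈ rowStochastic ℝ W)
    (hν : ∀ l ∈ D, ∀ π : W → ℝ, (π ∈ stdSimplex ℝ W ∧ π ᵥ* Q l = π) ↔ π = ν l)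
    (hcont : ContinuousOn Q D) {f : Y → W → ℝ} (hf : ContinuousOn f D) :
    ContinuousOn (fun l => poissonSolution (Q l) (f l)) D := by
  have h1 := continuousOn_inv_poissonMatrix hQ hν hcont
  rw [continuousOn_iff_continuous_domRestrict] at h1 hcont hf ⊢
  exact h1.matrix_mulVec (hcont.matrix_mulVec hf)

end Poisson

/-! ### Trajectories of the learning process -/

section Trajectory

variable {A : Type*} {S : A → Type*} [∀ i, DecidableEq (S i)] {W : Type*}
  {G : A → (∀ i, S i) → W → ℝ} {x0 θ0 : ∀ i, S i → ℝ} {s : ℕ → ∀ i, S i} {w : ℕ → W}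

theorem playCount_succ (θ0 : ∀ i, S i → ℝ) (s : ℕ → ∀ i, S i) (n : ℕ) (i : A) (r : S i) :
    playCount θ0 s (n + 1) i r = playCount θ0 s n i r + if s (n + 1) i = r then 1 else 0 := by
  unfold playCount
  rw [Finset.sum_Icc_succ_top (by omega), add_assoc]

theorem le_playCount (θ0 : ∀ i, S i → ℝ) (s : ℕ → ∀ i, S i) (n : ℕ) (i : A) (r : S i) :
    θ0 i r ≤ playCount θ0 s n i r :=
  le_add_of_nonneg_right (Finset.sum_nonneg fun _ _ => by split_ifs <;> norm_num)

theorem sum_playCount [∀ i, Fintype (S i)] (hθ0 : θ0 ∈ mixedProfiles S) (s : ℕ → ∀ i, S i)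
    (n : ℕ) (i : A) : ∑ r, playCount θ0 s n i r = n + 1 := by
  induction n with
  | zero => simpa [playCount] using (hθ0 i).2
  | succ n ih =>
    simp only [playCount_succ, Finset.sum_add_distrib, ih]
    simp

theorem frequency_mem_mixedProfiles [∀ i, Fintype (S i)] (hθ0 : θ0 ∈ mixedProfiles S)
    (s : ℕ → ∀ i, S i) (n : ℕ) : frequency θ0 s n ∈ mixedProfiles S := by
  refine fun i => ⟨fun r => div_nonneg (((hθ0 i).1 r).trans (le_playCount _ _ _ _ _))
    (by positivity), ?_⟩
  simp only [frequency]
  rw [← Finset.sum_div, sum_playCount hθ0]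
  exact div_self (by positivity)

theorem frequency_succ_sub (θ0 : ∀ i, S i → ℝ) (s : ℕ → ∀ i, S i) (n : ℕ) (i : A) (r : S i) :
    frequency θ0 s (n + 1) i r - frequency θ0 s n i r =
      1 / ((n : ℝ) + 2) * ((if s (n + 1) i = r then 1 else 0) - frequency θ0 s n i r) := by
  have h1 : (n : ℝ) + 1 ≠ 0 := by positivity
  have h2 : (n : ℝ) + 2 ≠ 0 := by positivity
  have h3 : (n : ℝ) + 1 + 1 ≠ 0 := by positivity
  unfold frequency
  rw [playCount_succ]
  push_cast
  field_simp
  ring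

/-- Since `θ n = (n + 1) λ n`, the random step `1 / θ n` is the deterministic step `1 / (n + 1)`
with a factor `1 / λ n` in the field. -/
theorem perception_succ_sub (G : A → (∀ i, S i) → W → ℝ) (x0 θ0 : ∀ i, S i → ℝ)
    (s : ℕ → ∀ i, S i) (w : ℕ → W) (n : ℕ) (i : A) (r : S i) :
    perception G x0 θ0 s w (n + 1) i r - perception G x0 θ0 s w n i r =
      1 / ((n : ℝ) + 1) * (if s (n + 1) i = r then
        (G i (s (n + 1)) (w (n + 1)) - perception G x0 θ0 s w n i r) / frequency θ0 s n i r
        else 0) := by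
  have h1 : (n : ℝ) + 1 ≠ 0 := by positivity
  simp only [perception]
  split_ifs with h
  · unfold frequency
    -- For a zero count both sides vanish by the convention for division by zero.
    rcases eq_or_ne (playCount θ0 s n i r) 0 with h0 | h0
    · simp [h0]
    · field_simp
      ring
  · simp

/-- Once `r` has been played, its count is at least `1` and every update is a convex combination.
Only the first update can have a negative weight `1 - 1 / θ0 i r`; the factor `1 + 1 / θ0 i r` pays
for it. -/
theorem abs_perception_le {M : A → ℝ} (hθ0pos : ∀ i r, 0 < θ0 i r)
    (hM : ∀ i r v, |G i r v| ≤ M i) (s : ℕ → ∀ i, S i) (w : ℕ → W) (n : ℕ) (i : A) (r : S i) :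
    |perception G x0 θ0 s w n i r| ≤ (1 + 1 / θ0 i r) * (|x0 i r| + M i) := by
  set K := (1 + 1 / θ0 i r) * (|x0 i r| + M i) with hK
  have hθ := hθ0pos i r
  have hM0 : 0 ≤ M i := (abs_nonneg _).trans (hM i (s 0) (w 0))
  have hinv : 0 < 1 / θ0 i r := by positivity
  have hx0 := abs_nonneg (x0 i r)
  have hxK : |x0 i r| ≤ K := by nlinarith
  have hMK : M i ≤ K := by nlinarith
  have key : (playCount θ0 s n i r = θ0 i r ∧ perception G x0 θ0 s w n i r = x0 i r) ∨
      (1 ≤ playCount θ0 s n i r ∧ |perception G x0 θ0 s w n i r| ≤ K) := by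
    induction n with
    | zero => left; simp [playCount, perception]
    | succ n ih =>
      have hg := hM i (s (n + 1)) (w (n + 1))
      by_cases h : s (n + 1) i = r
      · right
        simp only [playCount_succ, perception, if_pos h]
        rcases ih with ⟨h1, h2⟩ | ⟨h1, h2⟩
        · refine ⟨by linarith, ?_⟩
          rw [h1, h2]
          calc |(1 - 1 / θ0 i r) * x0 i r + 1 / θ0 i r * G i (s (n + 1)) (w (n + 1))|
              ≤ |1 - 1 / θ0 i r| * |x0 i r| + |1 / θ0 i r| * |G i (s (n + 1)) (w (n + 1))| := by
                rw [← abs_mul, ← abs_mul]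
                exact abs_add_le _ _
            _ ≤ (1 + 1 / θ0 i r) * |x0 i r| + 1 / θ0 i r * M i := by
                have h3 : |1 - 1 / θ0 i r| ≤ 1 + 1 / θ0 i r :=
                  abs_le.2 ⟨by linarith, by linarith⟩
                rw [abs_of_pos hinv]
                gcongr
            _ ≤ K := by rw [hK]; nlinarith
        · refine ⟨by linarith, ?_⟩
          have h3 : 0 ≤ 1 / playCount θ0 s n i r := by positivity
          have h4 : 1 / playCount θ0 s n i r ≤ 1 := by
            rw [div_le_one (by linarith)]
            exact h1
          set a := 1 / playCount θ0 s n i r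
          rw [abs_le] at h2 hg ⊢
          constructor <;> nlinarith
      · simp only [playCount_succ, perception, if_neg h, add_zero]
        exact ih
  rcases key with ⟨-, h⟩ | ⟨-, h⟩
  · rw [h]
    exact hxK
  · exact h

theorem playCount_congr {s' : ℕ → ∀ i, S i} {n : ℕ}
    (hs : ∀ m ∈ Finset.Icc 1 n, s m = s' m) : playCount θ0 s n = playCount θ0 s' n := by
  funext i r
  unfold playCount
  congr 1
  exact Finset.sum_congr rfl fun m hm => by rw [hs m hm]

theorem frequency_congr {s' : ℕ → ∀ i, S i} {n : ℕ}
    (hs : ∀ m ∈ Finset.Icc 1 n, s m = s' m) : frequency θ0 s n = frequency θ0 s' n := by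
  funext i r
  unfold frequency
  rw [playCount_congr hs]

theorem perception_congr {s' : ℕ → ∀ i, S i} {w' : ℕ → W} {n : ℕ}
    (hs : ∀ m ∈ Finset.Icc 1 n, s m = s' m) (hw : ∀ m ∈ Finset.Icc 1 n, w m = w' m) :
    perception G x0 θ0 s w n = perception G x0 θ0 s' w' n := by
  induction n with
  | zero => rfl
  | succ n ih =>
    have hsub : Finset.Icc 1 n ⊆ Finset.Icc 1 (n + 1) := Finset.Icc_subset_Icc_right n.le_succ
    have hmem : n + 1 ∈ Finset.Icc 1 (n + 1) := Finset.mem_Icc.2 ⟨by omega, le_rfl⟩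
    funext i r
    simp only [perception]
    rw [ih (fun m hm => hs m (hsub hm)) fun m hm => hw m (hsub hm),
      playCount_congr fun m hm => hs m (hsub hm), hs _ hmem, hw _ hmem]

end Trajectory

/-! ### The averaged field -/

section Field

variable {A : Type*} [Fintype A] [DecidableEq A] {S : A → Type*} [∀ i, Fintype (S i)]
  [∀ i, DecidableEq (S i)] {W : Type*} [Fintype W] [DecidableEq W]
  {G : A → (∀ i, S i) → W → ℝ} {σ : ∀ i, (S i → ℝ) → S i → ℝ}

omit [∀ i, DecidableEq (S i)] in
theorem sum_prod_eq_one {p : ∀ i, S i → ℝ} (hp : p ∈ mixedProfiles S) :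
    ∑ r : ∀ i, S i, ∏ j, p j (r j) = 1 := by
  have h := Finset.prod_univ_sum (fun _ => Finset.univ) p
  rw [Fintype.piFinset_univ] at h
  rw [← h]
  exact Finset.prod_eq_one fun i _ => (hp i).2

omit [∀ i, Fintype (S i)] in
-- Conditioning a product law on the choice of player `i` puts a Dirac mass in factor `i`. This is
-- the origin of the coefficient `σ` in front of the payoffs in the averaged field.
theorem ite_prod_eq_mul_prod_update (p : ∀ i, S i → ℝ) (i : A) (r : S i) (q : ∀ i, S i) :
    (if q i = r then ∏ j, p j (q j) else 0) =
      p i r * ∏ j, Function.update p i (Pi.single r 1) j (q j) := by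
  rw [← Finset.mul_prod_erase Finset.univ (fun j => Function.update p i (Pi.single r 1) j (q j))
    (Finset.mem_univ i), ← Finset.mul_prod_erase Finset.univ (fun j => p j (q j))
    (Finset.mem_univ i), Function.update_self]
  have h : ∏ j ∈ Finset.univ.erase i, Function.update p i (Pi.single r 1) j (q j) =
      ∏ j ∈ Finset.univ.erase i, p j (q j) :=
    Finset.prod_congr rfl fun j hj => by rw [Function.update_of_ne (Finset.ne_of_mem_erase hj)]
  rw [h]
  split_ifs with hq
  · rw [hq, Pi.single_eq_same, one_mul]
  · rw [Pi.single_eq_of_ne hq, zero_mul, mul_zero]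

/-- The velocity of the perception of the strategy `r` of player `i` when the state of the
environment is `v`. -/
noncomputable def stageField (G : A → (∀ i, S i) → W → ℝ) (σ : ∀ i, (S i → ℝ) → S i → ℝ)
    (i : A) (r : S i) (z : (∀ i, S i → ℝ) × (∀ i, S i → ℝ)) (v : W) : ℝ :=
  σ i (z.1 i) r / z.2 i r * (meanPayoff G σ z.1 (Pi.single v 1) i r - z.1 i r)

theorem meanPayoff_single (x : ∀ i, S i → ℝ) (v : W) (i : A) (r : S i) :
    meanPayoff G σ x (Pi.single v 1) i r =
      ∑ q : ∀ i, S i,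
        (∏ j, Function.update (fun j => σ j (x j)) i (Pi.single r 1) j (q j)) * G i q v := by
  unfold meanPayoff multilinearExt
  refine Finset.sum_congr rfl fun q _ => ?_
  rw [Finset.sum_eq_single v]
  · rw [Pi.single_eq_same, mul_one]
  · intro u _ hu
    rw [Pi.single_eq_of_ne hu, mul_zero, zero_mul]
  · intro h
    exact absurd (Finset.mem_univ v) h

theorem meanPayoff_eq_sum (x : ∀ i, S i → ℝ) (π : W → ℝ) (i : A) (r : S i) :
    meanPayoff G σ x π i r = ∑ v, π v * meanPayoff G σ x (Pi.single v 1) i r := by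
  simp only [meanPayoff_single]
  unfold meanPayoff multilinearExt
  rw [Finset.sum_comm]
  refine Finset.sum_congr rfl fun v _ => ?_
  rw [Finset.mul_sum]
  exact Finset.sum_congr rfl fun q _ => by ring

theorem averagedField_fst {τ : (∀ i, S i → ℝ) → W → ℝ}
    {z : (∀ i, S i → ℝ) × (∀ i, S i → ℝ)} (hτ : ∑ v, τ z.2 v = 1) (i : A) (r : S i) :
    (averagedField G σ τ z).1 i r = τ z.2 ⬝ᵥ stageField G σ i r z := by
  have h : z.1 i r = ∑ v, τ z.2 v * z.1 i r := by rw [← Finset.sum_mul, hτ, one_mul]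
  simp only [averagedField, dotProduct, stageField]
  rw [meanPayoff_eq_sum]
  conv_lhs => rw [h]
  rw [← Finset.sum_sub_distrib, Finset.mul_sum]
  exact Finset.sum_congr rfl fun v _ => by ring

/-- The mean increment of a perception, given the law `q` of the next state. -/
theorem sum_law_mul_increment (hσ : IsDecisionRule σ) (z : (∀ i, S i → ℝ) × (∀ i, S i → ℝ))
    (q : W → ℝ) (i : A) (r : S i) :
    ∑ p : ∀ i, S i, ∑ v, ((∏ j, σ j (z.1 j) (p j)) * q v) *
        (if p i = r then (G i p v - z.1 i r) / z.2 i r else 0) =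
      q ⬝ᵥ stageField G σ i r z := by
  have hupd : Function.update (fun j => σ j (z.1 j)) i (Pi.single r 1) ∈ mixedProfiles S := by
    intro j
    rcases eq_or_ne j i with rfl | hj
    · rw [Function.update_self]
      exact single_mem_stdSimplex ℝ r
    · rw [Function.update_of_ne hj]
      exact hσ.mem_simplex j _
  rw [Finset.sum_comm]
  refine Finset.sum_congr rfl fun v _ => ?_
  have h1 : ∀ p : ∀ i, S i, ((∏ j, σ j (z.1 j) (p j)) * q v) *
      (if p i = r then (G i p v - z.1 i r) / z.2 i r else 0) =
      q v * (σ i (z.1 i) r / z.2 i r * ((∏ j, Function.update (fun j => σ j (z.1 j)) i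
        (Pi.single r 1) j (p j)) * G i p v - (∏ j, Function.update (fun j => σ j (z.1 j)) i
        (Pi.single r 1) j (p j)) * z.1 i r)) := by
    intro p
    have h2 := ite_prod_eq_mul_prod_update (fun j => σ j (z.1 j)) i r p
    calc _ = (if p i = r then ∏ j, σ j (z.1 j) (p j) else 0) * q v *
          ((G i p v - z.1 i r) / z.2 i r) := by split_ifs <;> ring
      _ = _ := by
        rw [h2]
        ring
  simp only [h1]
  rw [← Finset.mul_sum, ← Finset.mul_sum, Finset.sum_sub_distrib, ← Finset.sum_mul,
    sum_prod_eq_one hupd, one_mul, ← meanPayoff_single]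
  rfl

omit [∀ i, DecidableEq (S i)] [DecidableEq W] in
theorem sum_law_mul_env (hσ : IsDecisionRule σ) (x : ∀ i, S i → ℝ) (q u : W → ℝ) :
    ∑ p : ∀ i, S i, ∑ v, ((∏ j, σ j (x j) (p j)) * q v) * u v = q ⬝ᵥ u := by
  have h := sum_prod_eq_one (p := fun j => σ j (x j)) fun j => hσ.mem_simplex j _
  calc _ = ∑ p : ∀ i, S i, (∏ j, σ j (x j) (p j)) * (q ⬝ᵥ u) := by
        refine Finset.sum_congr rfl fun p _ => ?_
        simp only [dotProduct, Finset.mul_sum]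
        exact Finset.sum_congr rfl fun v _ => by ring
    _ = _ := by rw [← Finset.sum_mul, h, one_mul]

omit [DecidableEq W] in
theorem sum_law_mul_play (hσ : IsDecisionRule σ) (x : ∀ i, S i → ℝ) {q : W → ℝ}
    (hq : ∑ v, q v = 1) (i : A) (r : S i) :
    ∑ p : ∀ i, S i, ∑ v, ((∏ j, σ j (x j) (p j)) * q v) * (if p i = r then 1 else 0) =
      σ i (x i) r := by
  have hupd : Function.update (fun j => σ j (x j)) i (Pi.single r 1) ∈ mixedProfiles S := by
    intro j
    rcases eq_or_ne j i with rfl | hj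
    · rw [Function.update_self]
      exact single_mem_stdSimplex ℝ r
    · rw [Function.update_of_ne hj]
      exact hσ.mem_simplex j _
  calc _ = ∑ p : ∀ i, S i, σ i (x i) r *
        ∏ j, Function.update (fun j => σ j (x j)) i (Pi.single r 1) j (p j) := by
        refine Finset.sum_congr rfl fun p _ => ?_
        rw [← ite_prod_eq_mul_prod_update (fun j => σ j (x j)), ← Finset.sum_mul,
          ← Finset.mul_sum, hq]
        split_ifs <;> ring
    _ = _ := by rw [← Finset.mul_sum, sum_prod_eq_one hupd, mul_one]

omit [DecidableEq A] [∀ i, DecidableEq (S i)] [Fintype A] in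
theorem isCompact_mixedProfiles : IsCompact (mixedProfiles S) := by
  have h : mixedProfiles S = Set.univ.pi fun i => stdSimplex ℝ (S i) := by
    ext l
    simp [mixedProfiles]
  rw [h]
  exact isCompact_univ_pi fun i => isCompact_stdSimplex ℝ (S i)

/-- The states with perceptions bounded by `K` and frequencies bounded below by `δ`. -/
def boundedStates (K δ : ∀ i, S i → ℝ) : Set ((∀ i, S i → ℝ) × (∀ i, S i → ℝ)) :=
  {z | (∀ i r, |z.1 i r| ≤ K i r) ∧ z.2 ∈ mixedProfiles S ∧ ∀ i r, δ i r ≤ z.2 i r}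

omit [DecidableEq A] [∀ i, DecidableEq (S i)] [Fintype A] in
theorem isCompact_boundedStates (K δ : ∀ i, S i → ℝ) : IsCompact (boundedStates K δ) := by
  have h1 : IsCompact ((Set.univ.pi fun i => Set.univ.pi fun r => Set.Icc (-K i r) (K i r)) ×ˢ
      mixedProfiles S) :=
    (isCompact_univ_pi fun i => isCompact_univ_pi fun r => isCompact_Icc).prod
      isCompact_mixedProfiles
  have h2 : IsClosed {z : (∀ i, S i → ℝ) × (∀ i, S i → ℝ) | ∀ i r, δ i r ≤ z.2 i r} := by
    simp only [Set.ofPred_forall]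
    exact isClosed_iInter fun i => isClosed_iInter fun r =>
      isClosed_le continuous_const (by fun_prop)
  convert h1.inter_right h2 using 1
  ext z
  simp only [boundedStates, Set.mem_ofPred_eq, Set.mem_inter_iff, Set.mem_prod, Set.mem_pi,
    Set.mem_univ, true_implies, Set.mem_Icc, abs_le, and_assoc]

theorem continuousOn_stageField (hσ : IsDecisionRule σ) {K δ : ∀ i, S i → ℝ}
    (hδ : ∀ i r, 0 < δ i r) (i : A) (r : S i) :
    ContinuousOn (stageField G σ i r) (boundedStates K δ) := by
  have hσc : ∀ j, Continuous fun z : (∀ i, S i → ℝ) × (∀ i, S i → ℝ) => σ j (z.1 j) := fun j =>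
    (hσ.continuous j).comp ((continuous_apply j).comp continuous_fst)
  refine continuousOn_pi.2 fun v => ?_
  unfold stageField
  refine ContinuousOn.mul (ContinuousOn.div ?_ ?_ ?_) (ContinuousOn.sub ?_ ?_)
  · exact ((continuous_apply r).comp (hσc i)).continuousOn
  · exact Continuous.continuousOn (by fun_prop)
  · exact fun z hz => ((hδ i r).trans_le (hz.2.2 i r)).ne'
  · simp only [meanPayoff_single]
    refine Continuous.continuousOn (continuous_finsetSum _ fun q _ =>
      Continuous.mul (continuous_finsetProd _ fun j _ => ?_) continuous_const)
    have h1 : Continuous fun z : (∀ i, S i → ℝ) × (∀ i, S i → ℝ) =>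
        Function.update (fun j => σ j (z.1 j)) i (Pi.single r 1) :=
      (continuous_pi hσc).update i continuous_const
    exact (continuous_apply (q j)).comp ((continuous_apply j).comp h1)
  · exact Continuous.continuousOn (by fun_prop)

theorem continuousOn_averagedField (hσ : IsDecisionRule σ) {K δ : ∀ i, S i → ℝ}
    (hδ : ∀ i r, 0 < δ i r) {τ : (∀ i, S i → ℝ) → W → ℝ}
    (hτ1 : ∀ l ∈ mixedProfiles S, τ l ∈ stdSimplex ℝ W)
    (hτ : ContinuousOn τ (mixedProfiles S)) :
    ContinuousOn (averagedField G σ τ) (boundedStates K δ) := by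
  refine ContinuousOn.prodMk ?_ ?_
  · refine continuousOn_pi.2 fun i => continuousOn_pi.2 fun r => ?_
    have h1 : ContinuousOn (fun z : (∀ i, S i → ℝ) × (∀ i, S i → ℝ) => τ z.2)
        (boundedStates K δ) := hτ.comp continuous_snd.continuousOn fun z hz => hz.2.1
    have h2 : ContinuousOn (fun z => τ z.2 ⬝ᵥ stageField G σ i r z) (boundedStates K δ) := by
      refine continuousOn_finsetSum _ fun v _ => ContinuousOn.mul ?_ ?_
      · exact continuousOn_pi.1 h1 v
      · exact continuousOn_pi.1 (continuousOn_stageField hσ hδ i r) v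
    exact h2.congr fun z hz => averagedField_fst (hτ1 _ hz.2.1).2 i r
  · refine Continuous.continuousOn (continuous_pi fun i => continuous_pi fun r => ?_)
    refine Continuous.sub ?_ (by fun_prop)
    exact (continuous_apply r).comp ((hσ.continuous i).comp
      ((continuous_apply i).comp continuous_fst))

end Field

/-! ### Series of martingale differences -/

/-- The partial sums form a martingale with orthogonal increments, so their second moments are at
most `∑ b n ^ 2`. From `|f| ≤ 1 + f ^ 2` they are bounded in `L¹`, and Doob's convergence theorem
applies. -/
theorem ae_exists_tendsto_sum_of_condExp_eq_zero {Ω : Type*} {m0 : MeasurableSpace Ω}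
    {μ : Measure Ω} [IsProbabilityMeasure μ] (ℱ : Filtration ℕ m0) {ξ : ℕ → Ω → ℝ} {b : ℕ → ℝ}
    (hmeas : ∀ n, Measurable[ℱ (n + 1)] (ξ n)) (hb : ∀ n ω, |ξ n ω| ≤ b n)
    (hsum : Summable fun n => b n ^ 2) (hc : ∀ n, μ[ξ n | ℱ n] =ᵐ[μ] 0) :
    ∀ᵐ ω ∂μ, ∃ c, Tendsto (fun n => ∑ k ∈ Finset.range n, ξ k ω) atTop (𝓝 c) := by
  set f : ℕ → Ω → ℝ := fun n ω => ∑ k ∈ Finset.range n, ξ k ω with hf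
  have hfsucc : ∀ n ω, f (n + 1) ω = f n ω + ξ n ω := fun n ω => Finset.sum_range_succ _ _
  have hfm : ∀ n, Measurable[ℱ n] (f n) := fun n =>
    Finset.measurable_fun_sum _ fun k hk =>
      (hmeas k).mono (ℱ.mono (Finset.mem_range.1 hk)) le_rfl
  have hfb : ∀ n ω, |f n ω| ≤ ∑ k ∈ Finset.range n, b k := fun n ω =>
    (Finset.abs_sum_le_sum_abs _ _).trans (Finset.sum_le_sum fun k _ => hb k ω)
  have hfm0 : ∀ n, Measurable (f n) := fun n => (hfm n).mono (ℱ.le n) le_rfl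
  have hξm0 : ∀ n, Measurable (ξ n) := fun n => (hmeas n).mono (ℱ.le _) le_rfl
  have hint : ∀ {g : Ω → ℝ} (B : ℝ), Measurable g → (∀ ω, |g ω| ≤ B) → Integrable g μ :=
    fun B hg hB => Integrable.of_bound hg.aestronglyMeasurable B (Eventually.of_forall hB)
  have hfi : ∀ n, Integrable (f n) μ := fun n => hint _ (hfm0 n) (hfb n)
  have hξi : ∀ n, Integrable (ξ n) μ := fun n => hint _ (hξm0 n) (hb n)
  have hmart : Martingale f ℱ μ := by
    refine martingale_of_condExp_sub_eq_zero_nat (fun n => (hfm n).stronglyMeasurable) hfi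
      fun n => ?_
    have h1 : f (n + 1) - f n = ξ n := funext fun ω => by
      rw [Pi.sub_apply, hfsucc, add_sub_cancel_left]
    rw [h1]
    exact hc n
  have hcross : ∀ n, ∫ ω, f n ω * ξ n ω ∂μ = 0 := by
    intro n
    have h1 : μ[f n * ξ n | ℱ n] =ᵐ[μ] f n * μ[ξ n | ℱ n] :=
      condExp_stronglyMeasurable_mul_of_bound (ℱ.le n) (hfm n).stronglyMeasurable (hξi n) _
        (Eventually.of_forall (hfb n))
    have h2 : μ[f n * ξ n | ℱ n] =ᵐ[μ] 0 := by
      filter_upwards [h1, hc n] with ω h3 h4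
      rw [h3, Pi.mul_apply, h4, Pi.zero_apply, mul_zero]
    have h3 := integral_condExp (μ := μ) (ℱ.le n) (f := f n * ξ n)
    rw [integral_congr_ae h2] at h3
    simpa using h3.symm
  have hsqi : ∀ {g : Ω → ℝ} (B : ℝ), Measurable g → (∀ ω, |g ω| ≤ B) →
      Integrable (fun ω => g ω ^ 2) μ := fun {g} B hg hB =>
    hint (B ^ 2) (hg.pow_const 2) fun ω => by
      rw [abs_pow]
      exact pow_le_pow_left₀ (abs_nonneg _) (hB ω) 2
  have hL2 : ∀ n, ∫ ω, f n ω ^ 2 ∂μ ≤ ∑ k ∈ Finset.range n, b k ^ 2 := by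
    intro n
    induction n with
    | zero => simp [hf]
    | succ n ih =>
      have h1 : (fun ω => f (n + 1) ω ^ 2) =
          fun ω => (f n ω ^ 2 + 2 * (f n ω * ξ n ω)) + ξ n ω ^ 2 := by
        funext ω
        rw [hfsucc]
        ring
      have hi1 := hsqi _ (hfm0 n) (hfb n)
      have hi2 : Integrable (fun ω => 2 * (f n ω * ξ n ω)) μ :=
        (hint ((∑ k ∈ Finset.range n, b k) * b n) ((hfm0 n).mul (hξm0 n)) fun ω => by
          rw [Pi.mul_apply, abs_mul]
          exact mul_le_mul (hfb n ω) (hb n ω) (abs_nonneg _)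
            ((abs_nonneg _).trans (hfb n ω))).const_mul 2
      have hi3 := hsqi _ (hξm0 n) (hb n)
      have hi12 : Integrable (fun ω => f n ω ^ 2 + 2 * (f n ω * ξ n ω)) μ := hi1.add hi2
      rw [h1, integral_add hi12 hi3, integral_add hi1 hi2, integral_const_mul, hcross,
        mul_zero, add_zero, Finset.sum_range_succ]
      refine add_le_add ih ?_
      calc ∫ ω, ξ n ω ^ 2 ∂μ ≤ ∫ _, b n ^ 2 ∂μ :=
            integral_mono hi3 (integrable_const _) fun ω => sq_le_sq' (abs_le.1 (hb n ω)).1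
              (abs_le.1 (hb n ω)).2
        _ = b n ^ 2 := by simp
  set R : ℝ := 1 + ∑' n, b n ^ 2 with hR
  refine hmart.submartingale.exists_ae_tendsto_of_bdd (R := R.toNNReal) fun n => ?_
  have h1 : ∫ ω, ‖f n ω‖ ∂μ ≤ R := by
    calc ∫ ω, ‖f n ω‖ ∂μ ≤ ∫ ω, (1 + f n ω ^ 2) ∂μ := by
          refine integral_mono (hfi n).norm ((integrable_const _).add (hsqi _ (hfm0 n) (hfb n)))
            fun ω => ?_
          rw [Real.norm_eq_abs]
          change |f n ω| ≤ 1 + f n ω ^ 2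
          nlinarith [sq_nonneg (|f n ω| - 1), sq_abs (f n ω)]
      _ = 1 + ∫ ω, f n ω ^ 2 ∂μ := by
          rw [integral_add (integrable_const _) (hsqi _ (hfm0 n) (hfb n))]
          simp
      _ ≤ R := by
          have := hsum.sum_le_tsum (Finset.range n) fun k _ => sq_nonneg _
          linarith [hL2 n]
  rw [eLpNorm_one_eq_lintegral_enorm, ← ofReal_integral_norm_eq_lintegral_enorm (hfi n)]
  exact ENNReal.ofReal_le_ofReal h1

/-! ### Functions of the history -/

section History

variable {Ω A : Type*} {S : A → Type*} {W : Type*}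

/-- The random variable `ψ` is a function of the history up to time `n`. -/
def DependsOnHistory {β : Type*} (s : ℕ → Ω → ∀ i, S i) (w : ℕ → Ω → W) (n : ℕ) (ψ : Ω → β) :
    Prop :=
  ∀ ω ω', w 0 ω = w 0 ω' → (∀ m ∈ Finset.Icc 1 n, s m ω = s m ω' ∧ w m ω = w m ω') → ψ ω = ψ ω'

theorem history_mono (s : ℕ → Ω → ∀ i, S i) (w : ℕ → Ω → W) : Monotone (history s w) :=
  fun _ _ hab => sup_le_sup_left
    (biSup_mono fun _ hm => Finset.Icc_subset_Icc_right hab hm) _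

/-- Histories up to time `n` take finitely many values, so `ψ` factors through a measurable map to a
finite discrete space. -/
theorem DependsOnHistory.measurable [Fintype A] [∀ i, Fintype (S i)] [Fintype W]
    {s : ℕ → Ω → ∀ i, S i} {w : ℕ → Ω → W} {n : ℕ} {ψ : Ω → ℝ} (h : DependsOnHistory s w n ψ) :
    Measurable[history s w n] ψ := by
  classical
  let H : Ω → W × (Finset.Icc 1 n → (∀ i, S i) × W) := fun ω => (w 0 ω, fun m => (s m ω, w m ω))
  have hfac : Function.FactorsThrough ψ H := fun ω ω' hω => by
    refine h ω ω' (congrArg Prod.fst hω) fun m hm => ?_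
    have h1 := congrFun (congrArg Prod.snd hω) ⟨m, hm⟩
    exact ⟨congrArg Prod.fst h1, congrArg Prod.snd h1⟩
  obtain ⟨φ, rfl⟩ := (Function.factorsThrough_iff ψ).1 hfac
  let : MeasurableSpace (W × (Finset.Icc 1 n → (∀ i, S i) × W)) := ⊤
  have hH : Measurable[history s w n] H := by
    let : MeasurableSpace Ω := history s w n
    refine measurable_to_countable' fun x => ?_
    have hpre : H ⁻¹' {x} = w 0 ⁻¹' {x.1} ∩
        ⋂ m : Finset.Icc 1 n, (s m ⁻¹' {(x.2 m).1} ∩ w m ⁻¹' {(x.2 m).2}) := by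
      ext ω
      simp only [H, Set.mem_preimage, Set.mem_singleton_iff, Set.mem_inter_iff, Set.mem_iInter,
        Prod.ext_iff, funext_iff]
    rw [hpre]
    refine MeasurableSet.inter ?_ (MeasurableSet.iInter fun m => MeasurableSet.inter ?_ ?_)
    · exact (le_sup_left : MeasurableSpace.comap (w 0) ⊤ ≤ history s w n) _ ⟨{x.1}, trivial, rfl⟩
    · have h1 : MeasurableSpace.comap (s m) ⊤ ≤ history s w n :=
        le_sup_left.trans ((le_iSup₂ (f := fun k (_ : k ∈ Finset.Icc 1 n) =>
          MeasurableSpace.comap (s k) ⊤ ⊔ MeasurableSpace.comap (w k) ⊤) m.1 m.2).trans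
            le_sup_right)
      exact h1 _ ⟨_, trivial, rfl⟩
    · have h1 : MeasurableSpace.comap (w m) ⊤ ≤ history s w n :=
        le_sup_right.trans ((le_iSup₂ (f := fun k (_ : k ∈ Finset.Icc 1 n) =>
          MeasurableSpace.comap (s k) ⊤ ⊔ MeasurableSpace.comap (w k) ⊤) m.1 m.2).trans
            le_sup_right)
      exact h1 _ ⟨_, trivial, rfl⟩
  exact (measurable_from_top (f := φ)).comp hH

theorem DependsOnHistory.mono {β : Type*} {s : ℕ → Ω → ∀ i, S i} {w : ℕ → Ω → W} {m n : ℕ}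
    {ψ : Ω → β} (h : DependsOnHistory s w m ψ) (hmn : m ≤ n) : DependsOnHistory s w n ψ :=
  fun ω ω' h0 h1 => h ω ω' h0 fun k hk => h1 k (Finset.Icc_subset_Icc_right hmn hk)

end History

/-! ### Martingale noise of the learning process -/

section Noise

variable {Ω : Type*} [MeasurableSpace Ω] {μ : Measure Ω}
  {A : Type*} [Fintype A] {S : A → Type*} [∀ i, DecidableEq (S i)] {W : Type*}
  {G : A → (∀ i, S i) → W → ℝ} {σ : ∀ i, (S i → ℝ) → S i → ℝ}
  {P : (∀ i, S i → ℝ) → Matrix W W ℝ} {x0 θ0 : ∀ i, S i → ℝ}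
  {s : ℕ → Ω → ∀ i, S i} {w : ℕ → Ω → W}

theorem IsLearningProcess.history_le (hproc : IsLearningProcess μ G σ P x0 θ0 s w) (n : ℕ) :
    history s w n ≤ ‹MeasurableSpace Ω› := by
  refine sup_le (hproc.measurable_env 0).comap_le (iSup₂_le fun m hm => sup_le ?_
    (hproc.measurable_env m).comap_le)
  obtain ⟨k, rfl⟩ : ∃ k, m = k + 1 := ⟨m - 1, by have := (Finset.mem_Icc.1 hm).1; omega⟩
  exact (hproc.measurable_play k).comap_le

/-- The filtration of the histories. -/
def IsLearningProcess.filtration (hproc : IsLearningProcess μ G σ P x0 θ0 s w) :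
    Filtration ℕ ‹MeasurableSpace Ω› where
  seq := history s w
  mono' := history_mono s w
  le' := hproc.history_le

omit [MeasurableSpace Ω] [Fintype A] in
theorem stateSeq_congr {ω ω' : Ω} {n : ℕ}
    (h : ∀ m ∈ Finset.Icc 1 n, s m ω = s m ω' ∧ w m ω = w m ω') :
    stateSeq G x0 θ0 (fun m => s m ω) (fun m => w m ω) n =
      stateSeq G x0 θ0 (fun m => s m ω') (fun m => w m ω') n :=
  Prod.ext (perception_congr (fun m hm => (h m hm).1) fun m hm => (h m hm).2)
    (frequency_congr fun m hm => (h m hm).1)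

omit [MeasurableSpace Ω] [Fintype A] [∀ i, DecidableEq (S i)] in
theorem env_congr {ω ω' : Ω} {n : ℕ} (h0 : w 0 ω = w 0 ω')
    (h : ∀ m ∈ Finset.Icc 1 n, s m ω = s m ω' ∧ w m ω = w m ω') : w n ω = w n ω' := by
  rcases Nat.eq_zero_or_pos n with rfl | hn
  · exact h0
  · exact (h n (Finset.mem_Icc.2 ⟨hn, le_rfl⟩)).2

/-- The probability, given the history up to time `n`, that the next profile is `r` and the next
state is `v`, as a function of the state `z` of the learning process and of the state `u` of the
environment. -/
def transitionLaw (σ : ∀ i, (S i → ℝ) → S i → ℝ) (P : (∀ i, S i → ℝ) → Matrix W W ℝ)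
    (z : (∀ i, S i → ℝ) × (∀ i, S i → ℝ)) (u : W) (r : ∀ i, S i) (v : W) : ℝ :=
  (∏ i, σ i (z.1 i) (r i)) * P z.2 u v

omit [∀ i, DecidableEq (S i)] in
theorem abs_indicator_sub_transitionLaw_le [∀ i, Fintype (S i)] [Fintype W] [DecidableEq W]
    (hσ : IsDecisionRule σ) (hP : ∀ l ∈ mixedProfiles S, P l ∈ Matrix.rowStochastic ℝ W)
    {z : (∀ i, S i → ℝ) × (∀ i, S i → ℝ)} (hz : z.2 ∈ mixedProfiles S) (u v : W) (r : ∀ i, S i)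
    (p : Prop) [Decidable p] :
    |(if p then (1 : ℝ) else 0) - transitionLaw σ P z u r v| ≤ 1 := by
  have h1 : 0 ≤ ∏ i, σ i (z.1 i) (r i) := Finset.prod_nonneg fun i _ => (hσ.pos i _ _).le
  have h2 : ∏ i, σ i (z.1 i) (r i) ≤ 1 := Finset.prod_le_one (fun i _ => (hσ.pos i _ _).le)
    fun i _ => ((hσ.mem_simplex i (z.1 i)).2 ▸ Finset.single_le_sum
      (fun q _ => (hσ.pos i (z.1 i) q).le) (Finset.mem_univ (r i)))
  have h3 : 0 ≤ P z.2 u v := Matrix.nonneg_of_mem_rowStochastic (hP _ hz)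
  have h4 : P z.2 u v ≤ 1 := Matrix.le_one_of_mem_rowStochastic (hP _ hz)
  have h5 : 0 ≤ transitionLaw σ P z u r v := mul_nonneg h1 h3
  have h6 : transitionLaw σ P z u r v ≤ 1 := mul_le_one₀ h2 h3 h4
  rw [abs_le]
  split_ifs <;> constructor <;> linarith

/-- The deviations of a small function of the next profile and state from its conditional mean
form a convergent series. -/
theorem IsLearningProcess.ae_exists_tendsto_sum_noise [DecidableEq A] [∀ i, Fintype (S i)]
    [Fintype W] [DecidableEq W]
    [IsProbabilityMeasure μ] (hproc : IsLearningProcess μ G σ P x0 θ0 s w)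
    (hσ : IsDecisionRule σ) (hP : ∀ l ∈ mixedProfiles S, P l ∈ Matrix.rowStochastic ℝ W)
    (hθ0 : θ0 ∈ mixedProfiles S) {ψ : ℕ → (∀ i, S i) → W → Ω → ℝ} {b : ℕ → ℝ}
    (hψ : ∀ n r v, DependsOnHistory s w n (ψ n r v)) (hb : ∀ n r v ω, |ψ n r v ω| ≤ b n)
    (hsum : Summable fun n => b n ^ 2) :
    ∀ᵐ ω ∂μ, ∃ c, Tendsto (fun n => ∑ k ∈ Finset.range n,
      (ψ k (s (k + 1) ω) (w (k + 1) ω) ω - ∑ r, ∑ v,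
        transitionLaw σ P (stateSeq G x0 θ0 (fun m => s m ω) (fun m => w m ω) k) (w k ω) r v *
          ψ k r v ω)) atTop (𝓝 c) := by
  let z : ℕ → Ω → (∀ i, S i → ℝ) × (∀ i, S i → ℝ) := fun n ω =>
    stateSeq G x0 θ0 (fun m => s m ω) (fun m => w m ω) n
  -- The noise is the finite sum over `(r, v)` of `ψ * D`, where `D` is an indicator minus its
  -- conditional probability and `ψ` is known at time `k`; each term is a martingale difference.
  let D : ℕ → (∀ i, S i) → W → Ω → ℝ := fun k r v ω =>
    (if s (k + 1) ω = r ∧ w (k + 1) ω = v then 1 else 0) - transitionLaw σ P (z k ω) (w k ω) r v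
  have hzmem : ∀ k ω, (z k ω).2 ∈ mixedProfiles S := fun k ω => frequency_mem_mixedProfiles hθ0 _ k
  have hD1 : ∀ k r v ω, |D k r v ω| ≤ 1 := fun k r v ω =>
    abs_indicator_sub_transitionLaw_le hσ hP (hzmem k ω) _ _ _ _
  have hlaw : ∀ k r v, DependsOnHistory s w k
      fun ω => transitionLaw σ P (z k ω) (w k ω) r v := by
    intro k r v ω ω' h0 h
    simp only [z]
    rw [stateSeq_congr h, env_congr h0 h]
  have hind : ∀ k r v, DependsOnHistory s w (k + 1) fun ω =>
      (if s (k + 1) ω = r ∧ w (k + 1) ω = v then (1 : ℝ) else 0) := by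
    intro k r v ω ω' h0 h
    have h1 := h (k + 1) (Finset.mem_Icc.2 ⟨by omega, le_rfl⟩)
    simp only [h1.1, h1.2]
  have key : ∀ r v, ∀ᵐ ω ∂μ, ∃ c,
      Tendsto (fun n => ∑ k ∈ Finset.range n, ψ k r v ω * D k r v ω) atTop (𝓝 c) := by
    intro r v
    refine ae_exists_tendsto_sum_of_condExp_eq_zero hproc.filtration (b := b) ?_ ?_ hsum ?_
    · intro k
      exact ((hψ k r v).mono k.le_succ).measurable.mul
        ((hind k r v).measurable.sub ((hlaw k r v).mono k.le_succ).measurable)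
    · intro k ω
      rw [abs_mul]
      exact (mul_le_mul (hb k r v ω) (hD1 k r v ω) (abs_nonneg _)
        ((abs_nonneg _).trans (hb k r v ω))).trans_eq (mul_one _)
    · intro k
      have hle := hproc.history_le k
      have hlm : Measurable[history s w k] fun ω => transitionLaw σ P (z k ω) (w k ω) r v :=
        (hlaw k r v).measurable
      have him : Measurable fun ω =>
          (if s (k + 1) ω = r ∧ w (k + 1) ω = v then (1 : ℝ) else 0) :=
        (hind k r v).measurable.mono (hproc.history_le _) le_rfl
      have hDm : Measurable (D k r v) := him.sub (hlm.mono hle le_rfl)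
      have hDi : Integrable (D k r v) μ :=
        Integrable.of_bound hDm.aestronglyMeasurable 1 (Eventually.of_forall (hD1 k r v))
      have hii : Integrable (fun ω =>
          (if s (k + 1) ω = r ∧ w (k + 1) ω = v then (1 : ℝ) else 0)) μ :=
        Integrable.of_bound him.aestronglyMeasurable 1
          (Eventually.of_forall fun ω => by split_ifs <;> simp)
      have hli : Integrable (fun ω => transitionLaw σ P (z k ω) (w k ω) r v) μ := by
        have h1 := hii.sub hDi
        refine h1.congr (Eventually.of_forall fun ω => ?_)
        simp [D]
      have h1 : μ[ψ k r v * D k r v | history s w k] =ᵐ[μ]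
          ψ k r v * μ[D k r v | history s w k] :=
        condExp_stronglyMeasurable_mul_of_bound hle (hψ k r v).measurable.stronglyMeasurable hDi
          (b k) (Eventually.of_forall (hb k r v))
      have h2 := condExp_sub hii hli (history s w k)
      have h3 := condExp_of_stronglyMeasurable hle hlm.stronglyMeasurable hli
      have h4 := hproc.cond_law k r v
      have h5 : {ω | s (k + 1) ω = r ∧ w (k + 1) ω = v}.indicator (fun _ => (1 : ℝ)) =
          fun ω => (if s (k + 1) ω = r ∧ w (k + 1) ω = v then (1 : ℝ) else 0) := by
        funext ω
        simp [Set.indicator]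
      rw [h5] at h4
      rw [h3] at h2
      filter_upwards [h1, h2, h4] with ω h6 h7 h8
      refine h6.trans ?_
      have h9 : (μ[D k r v | history s w k]) ω = 0 := by
        refine h7.trans ?_
        rw [Pi.sub_apply, h8]
        exact sub_self _
      rw [Pi.mul_apply, h9, mul_zero, Pi.zero_apply]
  filter_upwards [ae_all_iff.2 fun r => ae_all_iff.2 (key r)] with ω hω
  choose c hc using hω
  refine ⟨∑ r, ∑ v, c r v, ?_⟩
  have h1 := tendsto_finsetSum Finset.univ fun r _ =>
    tendsto_finsetSum Finset.univ fun v _ => hc r v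
  refine h1.congr fun n => ?_
  have h2 : ∀ k, ψ k (s (k + 1) ω) (w (k + 1) ω) ω - ∑ r, ∑ v,
      transitionLaw σ P (z k ω) (w k ω) r v * ψ k r v ω = ∑ r, ∑ v, ψ k r v ω * D k r v ω := by
    intro k
    have h3 : ∑ r, ∑ v, ψ k r v ω * (if s (k + 1) ω = r ∧ w (k + 1) ω = v then (1 : ℝ) else 0) =
        ψ k (s (k + 1) ω) (w (k + 1) ω) ω := by
      simp only [ite_and, mul_ite, mul_one, mul_zero]
      simp
    rw [← h3, ← Finset.sum_sub_distrib]
    refine Finset.sum_congr rfl fun r _ => ?_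
    rw [← Finset.sum_sub_distrib]
    refine Finset.sum_congr rfl fun v _ => ?_
    simp only [D]
    ring
  simp only [z] at h2
  simp only [h2]
  rw [Finset.sum_comm' (t' := Finset.univ) (s' := fun _ => Finset.range n)]
  · refine Finset.sum_congr rfl fun r _ => ?_
    rw [Finset.sum_comm]
  · simp

end Noise

/-! ### Perturbed solutions that are eventually in a compact set -/

/-- Dropping finitely many terms does not change the limit set. -/
theorem limitSet_of_eventually_perturbed {E : Type*} [NormedAddCommGroup E] [NormedSpace ℝ E]
    [ProperSpace E] {H : E → E} {C : Set E} {γ : ℕ → ℝ}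
    (hC : IsCompact C) (hH : ContinuousOn H C)
    (hγ : ∀ n, 0 < γ n) (hγ0 : Tendsto γ atTop (𝓝 0)) (hsum : Tendsto (clock γ) atTop atTop)
    {z e c : ℕ → E} {c' : E} (hz : ∀ᶠ n in atTop, z n ∈ C) (he : Tendsto e atTop (𝓝 0))
    (hc : Tendsto c atTop (𝓝 c'))
    (hrec : ∀ᶠ n in atTop, z (n + 1) - z n = γ n • (H (z n) + e n) + (c (n + 1) - c n)) :
    (limitSet z).Nonempty ∧ limitSet z ⊆ C ∧ IsICT H (limitSet z) ∧
      Tendsto (fun n => Metric.infDist (z n) (limitSet z)) atTop (𝓝 0) := by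
  obtain ⟨N, hN⟩ := eventually_atTop.1 (hz.and hrec)
  have hzN : ∀ n, z (n + N) ∈ C := fun n => (hN _ (Nat.le_add_left N n)).1
  have hsumN : Tendsto (clock fun n => γ (n + N)) atTop atTop := by
    have h1 : ∀ n, clock (fun n => γ (n + N)) n = -clock γ N + clock γ (n + N) := fun n => by
      unfold clock
      rw [Nat.add_comm n N, Finset.sum_range_add, neg_add_cancel_left]
      exact Finset.sum_congr rfl fun k _ => by rw [Nat.add_comm]
    exact (tendsto_atTop_add_const_left _ _ ((tendsto_add_atTop_iff_nat N).2 hsum)).congr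
      fun n => (h1 n).symm
  have hict := isICT_limitSet (z := fun n => z (n + N)) (e := fun n => e (n + N))
    (c := fun n => c (n + N)) hC hH (fun n => hγ (n + N))
    ((tendsto_add_atTop_iff_nat N).2 hγ0) hsumN hzN ((tendsto_add_atTop_iff_nat N).2 he)
    ((tendsto_add_atTop_iff_nat N).2 hc) fun n => by
      have := (hN _ (Nat.le_add_left N n)).2
      rwa [Nat.add_right_comm n N 1] at this
  have h1 := limitSet_nonempty hC hzN
  have h2 := limitSet_subset hC.isClosed hzN
  have h3 := tendsto_infDist_limitSet hC hzN
  rw [limitSet_shift] at hict h1 h2 h3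
  exact ⟨h1, h2, hict, (tendsto_add_atTop_iff_nat N).1 h3⟩

/-- Perturbations of the coordinates of a sequence combine into one of the sequence. -/
theorem exists_perturbation_pi {ι : Type*} [Finite ι] {κ : ι → Type*} [∀ i, Finite (κ i)]
    {γ : ℕ → ℝ} {x h : ℕ → ∀ i, κ i → ℝ}
    (hx : ∀ i r, ∃ (e c : ℕ → ℝ) (c' : ℝ), Tendsto e atTop (𝓝 0) ∧ Tendsto c atTop (𝓝 c') ∧
      ∀ᶠ n in atTop, x (n + 1) i r - x n i r = γ n * (h n i r + e n) + (c (n + 1) - c n)) :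
    ∃ (e c : ℕ → ∀ i, κ i → ℝ) (c' : ∀ i, κ i → ℝ), Tendsto e atTop (𝓝 0) ∧
      Tendsto c atTop (𝓝 c') ∧
      ∀ᶠ n in atTop, x (n + 1) - x n = γ n • (h n + e n) + (c (n + 1) - c n) := by
  choose e c c' he hc hrec using hx
  refine ⟨fun n i r => e i r n, fun n i r => c i r n, c',
    tendsto_pi_nhds.2 fun i => tendsto_pi_nhds.2 fun r => he i r,
    tendsto_pi_nhds.2 fun i => tendsto_pi_nhds.2 fun r => hc i r, ?_⟩
  filter_upwards [eventually_all.2 fun i => eventually_all.2 fun r => hrec i r] with n hn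
  exact funext fun i => funext fun r => hn i r

/-! ### Lower bound for the empirical frequencies -/

/-- Kronecker's lemma for the weights `1 / (k + 1)`. -/
theorem tendsto_mean_of_tendsto_sum_div {d : ℕ → ℝ} {c : ℝ}
    (h : Tendsto (fun n => ∑ k ∈ Finset.range n, 1 / ((k : ℝ) + 1) * d k) atTop (𝓝 c)) :
    Tendsto (fun n : ℕ => (n : ℝ)⁻¹ * ∑ k ∈ Finset.range n, d k) atTop (𝓝 0) := by
  set R : ℕ → ℝ := fun n => ∑ k ∈ Finset.range n, 1 / ((k : ℝ) + 1) * d k with hR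
  -- Summation by parts; after division by `n`, both terms tend to `c`, the second by Cesàro.
  have hsum : ∀ n : ℕ, ∑ k ∈ Finset.range n, d k = n * R n - ∑ k ∈ Finset.range n, R k := by
    intro n
    induction n with
    | zero => simp
    | succ n ih =>
      have h1 : R (n + 1) = R n + 1 / ((n : ℝ) + 1) * d n := Finset.sum_range_succ _ _
      have h2 : (n : ℝ) + 1 ≠ 0 := by positivity
      rw [Finset.sum_range_succ, Finset.sum_range_succ, ih, h1]
      push_cast
      field_simp
      ring
  have h1 := h.sub h.cesaro
  rw [sub_self] at h1
  refine h1.congr' ?_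
  filter_upwards [eventually_gt_atTop 0] with n hn
  have h2 : (n : ℝ) ≠ 0 := by positivity
  rw [hsum, mul_sub, inv_mul_cancel_left₀ h2]

section Trajectory

variable {A : Type*} {S : A → Type*} [∀ i, DecidableEq (S i)] {W : Type*}
  {θ0 : ∀ i, S i → ℝ} {s : ℕ → ∀ i, S i}

theorem playCount_eq_sum_range (θ0 : ∀ i, S i → ℝ) (s : ℕ → ∀ i, S i) (n : ℕ) (i : A) (r : S i) :
    playCount θ0 s n i r = θ0 i r + ∑ k ∈ Finset.range n, if s (k + 1) i = r then 1 else 0 := by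
  induction n with
  | zero => simp [playCount]
  | succ n ih => rw [playCount_succ, ih, Finset.sum_range_succ, add_assoc]

theorem eventually_le_frequency {i : A} {r : S i} {p : ℕ → ℝ} {η c : ℝ} (hθ0 : 0 ≤ θ0 i r)
    (hη : 0 < η) (hp : ∀ k, η ≤ p k)
    (h : Tendsto (fun n => ∑ k ∈ Finset.range n,
      1 / ((k : ℝ) + 1) * ((if s (k + 1) i = r then 1 else 0) - p k)) atTop (𝓝 c)) :
    ∀ᶠ n in atTop, η / 2 ≤ frequency θ0 s n i r := by
  have h1 := tendsto_mean_of_tendsto_sum_div h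
  -- The count is at least `n * η - n * η / 4`, and `3 * n / 4 ≥ (n + 1) / 2` as soon as `n ≥ 2`.
  filter_upwards [h1.eventually (lt_mem_nhds (show -(η / 4) < 0 by linarith)),
    eventually_ge_atTop 2] with n hn hn2
  have hn2' : (2 : ℝ) ≤ n := by exact_mod_cast hn2
  rw [Finset.sum_sub_distrib] at hn
  have h2 : (n : ℝ) * η ≤ ∑ k ∈ Finset.range n, p k := by
    have := Finset.card_nsmul_le_sum (Finset.range n) p η fun k _ => hp k
    simpa using this
  unfold frequency
  rw [le_div_iff₀ (by positivity), playCount_eq_sum_range]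
  have h3 : -(η / 4) * n ≤ ∑ k ∈ Finset.range n, (if s (k + 1) i = r then (1 : ℝ) else 0) -
      ∑ k ∈ Finset.range n, p k := by
    rw [inv_mul_eq_div, lt_div_iff₀ (by linarith)] at hn
    exact hn.le
  nlinarith

end Trajectory

/-! ### The recursion as a perturbation of the averaged dynamics -/

section Recursion

variable {A : Type*} {S : A → Type*} [∀ i, Fintype (S i)] [∀ i, DecidableEq (S i)] {W : Type*}
  {G : A → (∀ i, S i) → W → ℝ} {σ : ∀ i, (S i → ℝ) → S i → ℝ}
  {x0 θ0 K δ : ∀ i, S i → ℝ} {s : ℕ → ∀ i, S i} {w : ℕ → W}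

theorem tendsto_div_natCast_add_two (B : ℝ) :
    Tendsto (fun n : ℕ => B / ((n : ℝ) + 2)) atTop (𝓝 0) :=
  tendsto_const_nhds.div_atTop
    (tendsto_atTop_add_const_right _ _ tendsto_natCast_atTop_atTop)

theorem tendsto_div_natCast_add_one (B : ℝ) :
    Tendsto (fun n : ℕ => B / ((n : ℝ) + 1)) atTop (𝓝 0) :=
  tendsto_const_nhds.div_atTop
    (tendsto_atTop_add_const_right _ _ tendsto_natCast_atTop_atTop)

/-- Frequencies move with step `1 / (n + 2)`, perceptions with `1 / (n + 1)`. The discrepancy in the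
drift is a factor `1 - 1 / (n + 2)`, absorbed in `e`. -/
theorem frequency_perturbed (hσ : IsDecisionRule σ) (hθ0 : θ0 ∈ mixedProfiles S) (i : A) (r : S i)
    {x : ℕ → S i → ℝ} {c : ℝ}
    (h : Tendsto (fun n => ∑ k ∈ Finset.range n,
      1 / ((k : ℝ) + 2) * ((if s (k + 1) i = r then 1 else 0) - σ i (x k) r)) atTop (𝓝 c)) :
    ∃ (e C : ℕ → ℝ) (c' : ℝ), Tendsto e atTop (𝓝 0) ∧ Tendsto C atTop (𝓝 c') ∧
      ∀ᶠ n : ℕ in atTop, frequency θ0 s (n + 1) i r - frequency θ0 s n i r =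
        1 / ((n : ℝ) + 1) * ((σ i (x n) r - frequency θ0 s n i r) + e n) + (C (n + 1) - C n) := by
  refine ⟨fun n => -(σ i (x n) r - frequency θ0 s n i r) / ((n : ℝ) + 2), _, c, ?_, h, ?_⟩
  · refine squeeze_zero_norm (fun n => ?_) (tendsto_div_natCast_add_two 1)
    have h1 := mem_Icc_of_mem_stdSimplex (hσ.mem_simplex i (x n)) r
    have h2 := mem_Icc_of_mem_stdSimplex (frequency_mem_mixedProfiles hθ0 s n i) r
    rw [norm_div, Real.norm_eq_abs, Real.norm_of_nonneg (by positivity : 0 ≤ (n : ℝ) + 2)]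
    gcongr
    rw [abs_le]
    constructor <;> linarith [h1.1, h1.2, h2.1, h2.2]
  · refine Eventually.of_forall fun n => ?_
    have h1 : (n : ℝ) + 1 ≠ 0 := by positivity
    have h2 : (n : ℝ) + 2 ≠ 0 := by positivity
    rw [frequency_succ_sub, Finset.sum_range_succ]
    field_simp
    ring

theorem tendsto_stateSeq_succ_sub {M : A → ℝ} (hM : ∀ i r v, |G i r v| ≤ M i)
    (hδ : ∀ i r, 0 < δ i r) (hθ0 : θ0 ∈ mixedProfiles S)
    (hz : ∀ᶠ n in atTop, stateSeq G x0 θ0 s w n ∈ boundedStates K δ) :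
    Tendsto (fun n => stateSeq G x0 θ0 s w (n + 1) - stateSeq G x0 θ0 s w n) atTop (𝓝 0) := by
  refine Tendsto.prodMk_nhds (tendsto_pi_nhds.2 fun i => tendsto_pi_nhds.2 fun r => ?_)
    (tendsto_pi_nhds.2 fun i => tendsto_pi_nhds.2 fun r => ?_)
  · refine squeeze_zero_norm' ?_ (tendsto_div_natCast_add_one ((M i + K i r) / δ i r))
    filter_upwards [hz] with n hn
    have h1 : |perception G x0 θ0 s w n i r| ≤ K i r := hn.1 i r
    have h2 : δ i r ≤ frequency θ0 s n i r := hn.2.2 i r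
    have h3 := hδ i r
    have h4 := hM i (s (n + 1)) (w (n + 1))
    have h5 : 0 ≤ M i + K i r :=
      add_nonneg ((abs_nonneg _).trans h4) ((abs_nonneg _).trans h1)
    change ‖perception G x0 θ0 s w (n + 1) i r - perception G x0 θ0 s w n i r‖ ≤ _
    rw [perception_succ_sub, norm_mul, Real.norm_of_nonneg (by positivity), one_div_mul_eq_div]
    gcongr
    split_ifs
    · rw [norm_div, Real.norm_of_nonneg (h3.le.trans h2)]
      gcongr
      exact (norm_sub_le _ _).trans (add_le_add h4 h1)
    · rw [norm_zero]
      positivity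
  · refine squeeze_zero_norm (fun n => ?_) (tendsto_div_natCast_add_two 1)
    have h2 := mem_Icc_of_mem_stdSimplex (frequency_mem_mixedProfiles hθ0 s n i) r
    change ‖frequency θ0 s (n + 1) i r - frequency θ0 s n i r‖ ≤ _
    rw [frequency_succ_sub, norm_mul, Real.norm_of_nonneg (by positivity), one_div_mul_eq_div]
    gcongr
    rw [Real.norm_eq_abs, abs_le]
    split_ifs <;> constructor <;> linarith [h2.1, h2.2]

end Recursion

/-! ### Removal of the Markovian noise by the Poisson equation -/

section PerceptionRecursion

variable {A : Type*} [Fintype A] [DecidableEq A] {S : A → Type*} [∀ i, Fintype (S i)]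
  [∀ i, DecidableEq (S i)] {W : Type*} [Fintype W] [DecidableEq W]
  {G : A → (∀ i, S i) → W → ℝ} {σ : ∀ i, (S i → ℝ) → S i → ℝ}
  {P : (∀ i, S i → ℝ) → Matrix W W ℝ} {τ : (∀ i, S i → ℝ) → W → ℝ}
  {x0 θ0 K δ : ∀ i, S i → ℝ} {s : ℕ → ∀ i, S i} {w : ℕ → W}

/-- The corrector that removes the dependence of the mean increments on the state of the
environment. -/
noncomputable def corrector (G : A → (∀ i, S i) → W → ℝ) (σ : ∀ i, (S i → ℝ) → S i → ℝ)
    (P : (∀ i, S i → ℝ) → Matrix W W ℝ) (i : A) (r : S i)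
    (z : (∀ i, S i → ℝ) × (∀ i, S i → ℝ)) : W → ℝ :=
  poissonSolution (P z.2) (stageField G σ i r z)

open Classical in
/-- The increment of a perception plus the corrector, cut off outside of `boundedStates K δ`. -/
noncomputable def correctedIncrement (G : A → (∀ i, S i) → W → ℝ)
    (σ : ∀ i, (S i → ℝ) → S i → ℝ) (P : (∀ i, S i → ℝ) → Matrix W W ℝ) (K δ : ∀ i, S i → ℝ)
    (i : A) (r : S i) (z : (∀ i, S i → ℝ) × (∀ i, S i → ℝ)) (p : ∀ i, S i) (v : W) : ℝ :=
  if z ∈ boundedStates K δ then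
    (if p i = r then (G i p v - z.1 i r) / z.2 i r else 0) + corrector G σ P i r z v
  else 0

theorem continuousOn_corrector (hσ : IsDecisionRule σ)
    (hP : ∀ l ∈ mixedProfiles S, P l ∈ Matrix.rowStochastic ℝ W)
    (hτ : ∀ l ∈ mixedProfiles S, ∀ π : W → ℝ,
      (π ∈ stdSimplex ℝ W ∧ Matrix.vecMul π (P l) = π) ↔ π = τ l)
    (hPc : ContinuousOn P (mixedProfiles S)) (hδ : ∀ i r, 0 < δ i r) (i : A) (r : S i) :
    ContinuousOn (corrector G σ P i r) (boundedStates K δ) :=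
  continuousOn_poissonSolution (Q := fun z : (∀ i, S i → ℝ) × (∀ i, S i → ℝ) => P z.2)
    (ν := fun z => τ z.2) (fun _ hz => hP _ hz.2.1) (fun _ hz => hτ _ hz.2.1)
    (hPc.comp continuous_snd.continuousOn fun _ hz => hz.2.1) (continuousOn_stageField hσ hδ i r)

theorem exists_abs_corrector_le (hσ : IsDecisionRule σ)
    (hP : ∀ l ∈ mixedProfiles S, P l ∈ Matrix.rowStochastic ℝ W)
    (hτ : ∀ l ∈ mixedProfiles S, ∀ π : W → ℝ,
      (π ∈ stdSimplex ℝ W ∧ Matrix.vecMul π (P l) = π) ↔ π = τ l)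
    (hPc : ContinuousOn P (mixedProfiles S)) (hδ : ∀ i r, 0 < δ i r) (i : A) (r : S i) :
    ∃ B, ∀ z ∈ boundedStates K δ, ∀ v, |corrector G σ P i r z v| ≤ B := by
  obtain ⟨B, hB⟩ := ((isCompact_boundedStates K δ).image_of_continuousOn
    (continuousOn_corrector (G := G) hσ hP hτ hPc hδ i r)).isBounded.exists_norm_le
  exact ⟨B, fun z hz v => (norm_le_pi_norm _ v).trans (hB _ ⟨z, hz, rfl⟩)⟩

/-- The cut-off makes this bound hold for all `z`, so the noise series converges although a path
enters `boundedStates K δ` only after a random time. -/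
theorem exists_abs_correctedIncrement_le {M : A → ℝ} (hM : ∀ i r v, |G i r v| ≤ M i)
    (hσ : IsDecisionRule σ) (hP : ∀ l ∈ mixedProfiles S, P l ∈ Matrix.rowStochastic ℝ W)
    (hτ : ∀ l ∈ mixedProfiles S, ∀ π : W → ℝ,
      (π ∈ stdSimplex ℝ W ∧ Matrix.vecMul π (P l) = π) ↔ π = τ l)
    (hPc : ContinuousOn P (mixedProfiles S)) (hδ : ∀ i r, 0 < δ i r) (i : A) (r : S i) :
    ∃ B, ∀ z p v, |correctedIncrement G σ P K δ i r z p v| ≤ B := by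
  obtain ⟨B, hB⟩ := exists_abs_corrector_le (G := G) (K := K) hσ hP hτ hPc hδ i r
  refine ⟨|(M i + K i r) / δ i r| + |B|, fun z p v => ?_⟩
  unfold correctedIncrement
  split_ifs with hz hp
  · refine (abs_add_le _ _).trans (add_le_add ?_ ((hB z hz v).trans (le_abs_self B)))
    refine le_trans ?_ (le_abs_self _)
    have h1 := hz.1 i r
    have h2 := hM i p v
    have h3 := hδ i r
    have h4 := hz.2.2 i r
    rw [abs_div, abs_of_nonneg (h3.le.trans h4)]
    have h5 : |G i p v - z.1 i r| ≤ M i + K i r :=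
      (abs_sub _ _).trans (add_le_add h2 h1)
    exact div_le_div₀ ((abs_nonneg _).trans h5) h5 h3 h4
  · rw [zero_add]
    exact ((hB z hz v).trans (le_abs_self B)).trans (le_add_of_nonneg_left (abs_nonneg _))
  · rw [abs_zero]
    positivity

/-- The conditional mean of the corrected increment. -/
theorem sum_transitionLaw_mul_correctedIncrement (hσ : IsDecisionRule σ)
    (hP : ∀ l ∈ mixedProfiles S, P l ∈ Matrix.rowStochastic ℝ W)
    (hτ : ∀ l ∈ mixedProfiles S, ∀ π : W → ℝ,
      (π ∈ stdSimplex ℝ W ∧ Matrix.vecMul π (P l) = π) ↔ π = τ l)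
    {z : (∀ i, S i → ℝ) × (∀ i, S i → ℝ)} (hz : z ∈ boundedStates K δ) (u : W) (i : A) (r : S i) :
    ∑ p, ∑ v, transitionLaw σ P z u p v * correctedIncrement G σ P K δ i r z p v =
      (averagedField G σ τ z).1 i r + corrector G σ P i r z u := by
  have hτz := ((hτ _ hz.2.1 _).2 rfl).1
  simp only [correctedIncrement, if_pos hz, transitionLaw, mul_add, Finset.sum_add_distrib]
  rw [sum_law_mul_increment hσ, sum_law_mul_env hσ, averagedField_fst hτz.2,
    ← poissonSolution_spec (hP _ hz.2.1) (hτ _ hz.2.1) _ u]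
  simp only [corrector, Matrix.mulVec]
  ring

/-- By the Poisson equation the increment equals averaged field + martingale difference + `u n (w n)
- u n (w (n+1))`, where `u n` is the corrector at `z n`. Weighted by `1 / (n + 1)`, the last
difference telescopes, up to the changes of the corrector and of the step size. -/
theorem perception_perturbed {M : A → ℝ} (hM : ∀ i r v, |G i r v| ≤ M i)
    (hσ : IsDecisionRule σ) (hP : ∀ l ∈ mixedProfiles S, P l ∈ Matrix.rowStochastic ℝ W)
    (hτ : ∀ l ∈ mixedProfiles S, ∀ π : W → ℝ,
      (π ∈ stdSimplex ℝ W ∧ Matrix.vecMul π (P l) = π) ↔ π = τ l)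
    (hPc : ContinuousOn P (mixedProfiles S)) (hδ : ∀ i r, 0 < δ i r)
    (hθ0 : θ0 ∈ mixedProfiles S) (i : A) (r : S i)
    {z : ℕ → (∀ i, S i → ℝ) × (∀ i, S i → ℝ)} (hzdef : z = stateSeq G x0 θ0 s w)
    (hz : ∀ᶠ n in atTop, z n ∈ boundedStates K δ) {c : ℝ}
    (h : Tendsto (fun n => ∑ k ∈ Finset.range n, 1 / ((k : ℝ) + 1) *
      (correctedIncrement G σ P K δ i r (z k) (s (k + 1)) (w (k + 1)) -
        ∑ p, ∑ v, transitionLaw σ P (z k) (w k) p v *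
          correctedIncrement G σ P K δ i r (z k) p v)) atTop (𝓝 c)) :
    ∃ (e C : ℕ → ℝ) (c' : ℝ), Tendsto e atTop (𝓝 0) ∧ Tendsto C atTop (𝓝 c') ∧
      ∀ᶠ n : ℕ in atTop, (z (n + 1)).1 i r - (z n).1 i r =
        1 / ((n : ℝ) + 1) * ((averagedField G σ τ (z n)).1 i r + e n) + (C (n + 1) - C n) := by
  obtain ⟨B, hB⟩ := exists_abs_corrector_le (G := G) (K := K) hσ hP hτ hPc hδ i r
  set u : ℕ → W → ℝ := fun n => corrector G σ P i r (z n) with hu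
  have hub : ∀ᶠ n in atTop, ∀ v, |u n v| ≤ B := hz.mono fun n hn => hB _ hn
  have hzsub : Tendsto (fun n => dist (z (n + 1)) (z n)) atTop (𝓝 0) := by
    simp only [dist_eq_norm]
    subst hzdef
    have := (tendsto_stateSeq_succ_sub hM hδ hθ0 hz).norm
    rwa [norm_zero] at this
  -- The corrector is uniformly continuous on the compact set and consecutive states get close.
  have husub : Tendsto (fun n => u (n + 1) (w (n + 1)) - u n (w (n + 1))) atTop (𝓝 0) := by
    have huc := (isCompact_boundedStates K δ).uniformContinuousOn_of_continuous
      (continuousOn_corrector (G := G) hσ hP hτ hPc hδ i r)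
    rw [Metric.tendsto_nhds]
    intro ε hε
    obtain ⟨ρ, hρ, hρε⟩ := Metric.uniformContinuousOn_iff.1 huc ε hε
    filter_upwards [hz, (tendsto_add_atTop_nat 1).eventually hz,
      hzsub.eventually (gt_mem_nhds hρ)] with n h1 h2 h3
    rw [dist_zero_right, ← dist_eq_norm]
    exact (dist_le_pi_dist _ _ _).trans_lt (hρε _ h2 _ h1 h3)
  -- The term `-u n (w n) / (n + 1)` in `C` carries the telescoping part. In `e`, the quotient by `n
  -- + 2` comes from `1 / (n + 2) - 1 / (n + 1) = -1 / ((n + 1) * (n + 2))`.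
  refine ⟨fun n => (u (n + 1) (w (n + 1)) - u n (w (n + 1))) -
    u (n + 1) (w (n + 1)) / ((n : ℝ) + 2), fun n => (∑ k ∈ Finset.range n, 1 / ((k : ℝ) + 1) *
      (correctedIncrement G σ P K δ i r (z k) (s (k + 1)) (w (k + 1)) -
        ∑ p, ∑ v, transitionLaw σ P (z k) (w k) p v *
          correctedIncrement G σ P K δ i r (z k) p v)) - u n (w n) / ((n : ℝ) + 1), c, ?_, ?_, ?_⟩
  · have h1 : Tendsto (fun n : ℕ => u (n + 1) (w (n + 1)) / ((n : ℝ) + 2)) atTop (𝓝 0) := by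
      refine squeeze_zero_norm' ?_ (tendsto_div_natCast_add_two B)
      filter_upwards [(tendsto_add_atTop_nat 1).eventually hub] with n hn
      rw [norm_div, Real.norm_of_nonneg (by positivity : 0 ≤ (n : ℝ) + 2)]
      gcongr
      exact hn _
    simpa using husub.sub h1
  · have h1 : Tendsto (fun n : ℕ => u n (w n) / ((n : ℝ) + 1)) atTop (𝓝 0) := by
      refine squeeze_zero_norm' ?_ (tendsto_div_natCast_add_one B)
      filter_upwards [hub] with n hn
      rw [norm_div, Real.norm_of_nonneg (by positivity : 0 ≤ (n : ℝ) + 1)]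
      gcongr
      exact hn _
    simpa using h.sub h1
  · filter_upwards [hz] with n hn
    have h1 : (n : ℝ) + 1 ≠ 0 := by positivity
    have h2 : (n : ℝ) + 2 ≠ 0 := by positivity
    have h3 : (n : ℝ) + 1 + 1 ≠ 0 := by positivity
    rw [Finset.sum_range_succ, sum_transitionLaw_mul_correctedIncrement hσ hP hτ hn,
      correctedIncrement, if_pos hn]
    have h4 : (z (n + 1)).1 i r - (z n).1 i r = 1 / ((n : ℝ) + 1) *
        (if s (n + 1) i = r then (G i (s (n + 1)) (w (n + 1)) - (z n).1 i r) / (z n).2 i r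
          else 0) := by
      subst hzdef
      exact perception_succ_sub G x0 θ0 s w n i r
    rw [h4]
    simp only [hu]
    push_cast
    field_simp
    ring

end PerceptionRecursion

/-! ### Almost sure convergence of the noise series -/

section Convergence

variable {A : Type*} [Fintype A] [DecidableEq A] {S : A → Type*} [∀ i, Fintype (S i)]
  [∀ i, DecidableEq (S i)] {W : Type*} [Fintype W] [DecidableEq W]
  {G : A → (∀ i, S i) → W → ℝ} {σ : ∀ i, (S i → ℝ) → S i → ℝ}
  {P : (∀ i, S i → ℝ) → Matrix W W ℝ} {τ : (∀ i, S i → ℝ) → W → ℝ}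
  {x0 θ0 K : ∀ i, S i → ℝ}

omit [Fintype A] [DecidableEq A] [∀ i, DecidableEq (S i)] in
theorem IsDecisionRule.exists_lower_bound (hσ : IsDecisionRule σ) (K : ∀ i, S i → ℝ) (i : A)
    (r : S i) : ∃ η > 0, ∀ y : S i → ℝ, (∀ q, |y q| ≤ K i q) → η ≤ σ i y r := by
  have hcomp : IsCompact (Set.univ.pi fun q => Set.Icc (-K i q) (K i q)) :=
    isCompact_univ_pi fun q => isCompact_Icc
  have hcont : Continuous fun y => σ i y r := (continuous_apply r).comp (hσ.continuous i)
  obtain ⟨η, hη, h⟩ := hcomp.exists_forall_le' hcont.continuousOn (a := 0)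
    fun y _ => hσ.pos i y r
  exact ⟨η, hη, fun y hy => h y fun q _ => abs_le.1 (hy q)⟩

theorem summable_sq_div_natCast_add_one (B : ℝ) :
    Summable fun n : ℕ => (1 / ((n : ℝ) + 1) * B) ^ 2 := by
  have h1 := (summable_nat_add_iff 1).2 (Real.summable_one_div_nat_pow.2 one_lt_two)
  refine (h1.mul_right (B ^ 2)).congr fun n => ?_
  push_cast
  rw [mul_pow, div_pow, one_pow]

variable {Ω : Type*} [MeasurableSpace Ω] {μ : Measure Ω} [IsProbabilityMeasure μ]
  {s : ℕ → Ω → ∀ i, S i} {w : ℕ → Ω → W}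

/-- The weights `a` are kept general for two uses: `1 / (n + 1)` for the lower bound on frequencies
by Kronecker's lemma, `1 / (n + 2)` for the frequency recursion. -/
theorem IsLearningProcess.ae_exists_tendsto_sum_play
    (hproc : IsLearningProcess μ G σ P x0 θ0 s w) (hσ : IsDecisionRule σ)
    (hP : ∀ l ∈ mixedProfiles S, P l ∈ Matrix.rowStochastic ℝ W) (hθ0 : θ0 ∈ mixedProfiles S)
    {a : ℕ → ℝ} (ha0 : ∀ n, 0 ≤ a n) (ha : ∀ n, a n ≤ 1 / ((n : ℝ) + 1)) (i : A) (r : S i) :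
    ∀ᵐ ω ∂μ, ∃ c, Tendsto (fun n => ∑ k ∈ Finset.range n,
      a k * ((if s (k + 1) ω i = r then 1 else 0) -
        σ i (perception G x0 θ0 (fun m => s m ω) (fun m => w m ω) k i) r)) atTop (𝓝 c) := by
  have hsum : Summable fun n => a n ^ 2 :=
    (summable_sq_div_natCast_add_one 1).of_nonneg_of_le (fun n => sq_nonneg _) fun n => by
      rw [mul_one]
      exact pow_le_pow_left₀ (ha0 n) (ha n) 2
  have h := hproc.ae_exists_tendsto_sum_noise hσ hP hθ0
    (ψ := fun k p _ _ => a k * if p i = r then 1 else 0) (b := a)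
    (fun _ _ _ _ _ _ _ => rfl) (fun n p v ω => by
      rw [abs_mul, abs_of_nonneg (ha0 n)]
      refine mul_le_of_le_one_right (ha0 n) ?_
      split_ifs <;> simp) hsum
  filter_upwards [h] with ω hω
  obtain ⟨c, hc⟩ := hω
  refine ⟨c, hc.congr fun n => Finset.sum_congr rfl fun k _ => ?_⟩
  have h1 := sum_law_mul_play hσ (perception G x0 θ0 (fun m => s m ω) (fun m => w m ω) k)
    (q := P (frequency θ0 (fun m => s m ω) k) (w k ω)) (Matrix.sum_row_of_mem_rowStochastic
      (hP _ (frequency_mem_mixedProfiles hθ0 _ k)) _) i r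
  rw [mul_sub, ← h1, Finset.mul_sum]
  congr 1
  refine Finset.sum_congr rfl fun p _ => ?_
  rw [Finset.mul_sum]
  refine Finset.sum_congr rfl fun v _ => ?_
  simp only [transitionLaw, stateSeq]
  ring

theorem IsLearningProcess.ae_exists_tendsto_sum_correctedIncrement
    (hproc : IsLearningProcess μ G σ P x0 θ0 s w) (hσ : IsDecisionRule σ)
    (hP : ∀ l ∈ mixedProfiles S, P l ∈ Matrix.rowStochastic ℝ W) (hθ0 : θ0 ∈ mixedProfiles S)
    {δ : ∀ i, S i → ℝ} {i : A} {r : S i} {B : ℝ}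
    (hB : ∀ z p v, |correctedIncrement G σ P K δ i r z p v| ≤ B) :
    ∀ᵐ ω ∂μ, ∃ c, Tendsto (fun n => ∑ k ∈ Finset.range n, 1 / ((k : ℝ) + 1) *
      (correctedIncrement G σ P K δ i r
          (stateSeq G x0 θ0 (fun m => s m ω) (fun m => w m ω) k) (s (k + 1) ω) (w (k + 1) ω) -
        ∑ p, ∑ v, transitionLaw σ P
          (stateSeq G x0 θ0 (fun m => s m ω) (fun m => w m ω) k) (w k ω) p v *
          correctedIncrement G σ P K δ i r
            (stateSeq G x0 θ0 (fun m => s m ω) (fun m => w m ω) k) p v)) atTop (𝓝 c) := by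
  have h := hproc.ae_exists_tendsto_sum_noise hσ hP hθ0
    (ψ := fun k p v ω => 1 / ((k : ℝ) + 1) * correctedIncrement G σ P K δ i r
      (stateSeq G x0 θ0 (fun m => s m ω) (fun m => w m ω) k) p v)
    (b := fun n => 1 / ((n : ℝ) + 1) * B)
    (fun n p v ω ω' _ hω => by simp only [stateSeq_congr hω]) (fun n p v ω => by
      rw [abs_mul, abs_of_nonneg (by positivity)]
      exact mul_le_mul_of_nonneg_left (hB _ _ _) (by positivity))
    (summable_sq_div_natCast_add_one B)
  filter_upwards [h] with ω hω
  obtain ⟨c, hc⟩ := hω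
  refine ⟨c, hc.congr fun n => Finset.sum_congr rfl fun k _ => ?_⟩
  rw [mul_sub, Finset.mul_sum]
  congr 1
  refine Finset.sum_congr rfl fun p _ => ?_
  rw [Finset.mul_sum]
  exact Finset.sum_congr rfl fun v _ => by ring

end Convergence

end RandomEnvLearning

/-! ### Proof of the convergence theorem -/

open RandomEnvLearning in
theorem mainTheorem8
    {A : Type*} [Fintype A] [DecidableEq A]
    {S : A → Type*} [∀ i, Fintype (S i)] [∀ i, DecidableEq (S i)]
    {W : Type*} [Fintype W] [DecidableEq W]
    (G : A → (∀ i, S i) → W → ℝ)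
    (σ : ∀ i, (S i → ℝ) → S i → ℝ) (hσ : IsDecisionRule σ)
    (P : (∀ i, S i → ℝ) → Matrix W W ℝ)
    (hP : ∀ l ∈ mixedProfiles S, P l ∈ Matrix.rowStochastic ℝ W)
    (τ : (∀ i, S i → ℝ) → W → ℝ)
    (hτ : ∀ l ∈ mixedProfiles S, ∀ π : W → ℝ,
      (π ∈ stdSimplex ℝ W ∧ Matrix.vecMul π (P l) = π) ↔ π = τ l)
    (hPC1 : ∀ v v' : W, ContDiffOn ℝ 1 (fun l => P l v v') (mixedProfiles S))
    (x0 θ0 : ∀ i, S i → ℝ) (hθ0 : θ0 ∈ mixedProfiles S) (hθ0pos : ∀ i r, 0 < θ0 i r)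
    {Ω : Type*} [MeasurableSpace Ω] (μ : Measure Ω) [IsProbabilityMeasure μ]
    (s : ℕ → Ω → ∀ i, S i) (w : ℕ → Ω → W)
    (hproc : IsLearningProcess μ G σ P x0 θ0 s w) :
    ∀ᵐ ω ∂μ,
      let z : ℕ → (∀ i, S i → ℝ) × (∀ i, S i → ℝ) :=
        stateSeq G x0 θ0 (fun m => s m ω) (fun m => w m ω)
      (limitSet z).Nonempty ∧ limitSet z ⊆ stateSpace S ∧
        IsICT (averagedField G σ τ) (limitSet z) ∧
        Tendsto (fun n => Metric.infDist (z n) (limitSet z)) atTop (𝓝 0) := by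
  have hPc : ContinuousOn P (mixedProfiles S) :=
    continuousOn_pi.2 fun v => continuousOn_pi.2 fun v' => (hPC1 v v').continuousOn
  have hτc : ContinuousOn τ (mixedProfiles S) := continuousOn_invariant hP hτ hPc
  have hM : ∀ i, ∃ M, ∀ r v, |G i r v| ≤ M := fun i => by
    obtain ⟨M, hM⟩ := Finite.exists_le fun p : (∀ i, S i) × W => |G i p.1 p.2|
    exact ⟨M, fun r v => hM (r, v)⟩
  choose M hM using hM
  -- `K` and `δ` do not depend on `ω`, so one compact set serves for all paths; `η` is the minimal
  -- choice probability on the box given by `K`.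
  let K : ∀ i, S i → ℝ := fun i r => (1 + 1 / θ0 i r) * (|x0 i r| + M i)
  choose η hη hση using fun i => hσ.exists_lower_bound K i
  let δ : ∀ i, S i → ℝ := fun i r => η i r / 2
  have hδ : ∀ i r, 0 < δ i r := fun i r => half_pos (hη i r)
  choose B hB using exists_abs_correctedIncrement_le (K := K) hM hσ hP hτ hPc hδ
  have hplay1 := ae_all_iff.2 fun i => ae_all_iff.2 (hproc.ae_exists_tendsto_sum_play hσ hP hθ0
    (a := fun n => 1 / ((n : ℝ) + 1)) (fun n => by positivity) (fun n => le_rfl) i)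
  have hplay2 := ae_all_iff.2 fun i => ae_all_iff.2 (hproc.ae_exists_tendsto_sum_play hσ hP hθ0
    (a := fun n => 1 / ((n : ℝ) + 2)) (fun n => by positivity)
    (fun n => one_div_le_one_div_of_le (by positivity) (by linarith)) i)
  have hincr := ae_all_iff.2 fun i => ae_all_iff.2 fun r =>
    hproc.ae_exists_tendsto_sum_correctedIncrement hσ hP hθ0 (hB i r)
  -- From here on the argument is deterministic, for a path along which all noise series converge.
  filter_upwards [hplay1, hplay2, hincr] with ω h1 h2 h3
  intro z
  have hzK : ∀ n i r, |(z n).1 i r| ≤ K i r := fun n i r =>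
    abs_perception_le hθ0pos hM (fun m => s m ω) (fun m => w m ω) n i r
  have hzmem : ∀ᶠ n in atTop, z n ∈ boundedStates K δ := by
    have h4 : ∀ᶠ n in atTop, ∀ i r, δ i r ≤ (z n).2 i r :=
      eventually_all.2 fun i => eventually_all.2 fun r => by
        obtain ⟨c, hc⟩ := h1 i r
        exact eventually_le_frequency (hθ0pos i r).le (hη i r)
          (fun k => hση i r _ (hzK k i)) hc
    exact h4.mono fun n hn => ⟨hzK n, frequency_mem_mixedProfiles hθ0 _ n, hn⟩
  choose c2 hc2 using h2
  choose c3 hc3 using h3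
  obtain ⟨ex, Cx, cx, hex, hCx, hrecx⟩ := exists_perturbation_pi
    (γ := fun n : ℕ => 1 / ((n : ℝ) + 1)) (x := fun n => (z n).1)
    (h := fun n => (averagedField G σ τ (z n)).1) fun i r =>
      perception_perturbed hM hσ hP hτ hPc hδ hθ0 i r rfl hzmem (hc3 i r)
  obtain ⟨el, Cl, cl, hel, hCl, hrecl⟩ := exists_perturbation_pi
    (γ := fun n : ℕ => 1 / ((n : ℝ) + 1)) (x := fun n => (z n).2)
    (h := fun n => (averagedField G σ τ (z n)).2) fun i r =>
      frequency_perturbed hσ hθ0 i r (hc2 i r)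
  have hfinal := limitSet_of_eventually_perturbed (H := averagedField G σ τ) (z := z)
    (γ := fun n : ℕ => 1 / ((n : ℝ) + 1)) (isCompact_boundedStates K δ)
    (continuousOn_averagedField hσ hδ (fun l hl => ((hτ l hl _).2 rfl).1) hτc)
    (fun n => by positivity) (tendsto_div_natCast_add_one 1)
    Real.tendsto_sum_range_one_div_nat_succ_atTop
    (e := fun n => (ex n, el n)) (c := fun n => (Cx n, Cl n)) (c' := (cx, cl)) hzmem
    (hex.prodMk_nhds hel) (hCx.prodMk_nhds hCl)
    ((hrecx.and hrecl).mono fun n hn => Prod.ext hn.1 hn.2)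
  exact ⟨hfinal.1, fun y hy => ⟨(hfinal.2.1 hy).2.1,
    fun i r => (hδ i r).trans_le ((hfinal.2.1 hy).2.2 i r)⟩, hfinal.2.2⟩
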